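/- **Theorem 2.** For $2\times 2$ complex matrices $A,B$ let $G(A,B)$ be the two-qubit operator that acts as $A$ on the even-parity subspace with ordered basis $|00\rangle,|11\rangle$ and as $B$ on the odd-parity subspace with ordered basis $|01\rangle,|10\rangle$. A unitary operator of the form $G(C,D)$ is called parity-preserving; it is a matchgate if $\det C=\det D$. Let $G(A,B)$ be any parity-preserving unitary that is not a matchgate, i.e. $\det A\neq\det B$, and let $M$ be the set consisting of all matchgates and $G(A,B)$. Then the gates of $M$, acting only on nearest-neighbour pairs $(i,i+1)$ of a line of qubits, are universal for quantum computation in the encoding $|0\rangle_L=|00\rangle$, $|1\rangle_L=|11\rangle$, where $n$ logical qubits are encoded in consecutive pairs of a line of $2n$ physical qubits by the isometry $E_n\colon(\mathbb C^2)^{\otimes n}\to(\mathbb C^2)^{\otimes 2n}$, $E_n|x_1x_2\cdots x_n\rangle=|x_1x_1x_2x_2\cdots x_nx_n\rangle$. That is: 1. For every $n\ge 1$ and every unitary $U$ on $n$ qubits there is a finite nearest-neighbour circuit on $2n$ qubits with gates in $M$ whose operator $V$ satisfies $VE_n=E_nU$. 2. There is a constant $K$, depending only on $A$ and $B$, such that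 for all $n$ and $m$ and every circuit of $m$ one- and two-qubit unitary gates acting on arbitrary qubits and pairs of qubits among $n$ qubits, with operator $U$, there is a nearest-neighbour circuit on $2n$ qubits of at most $K\,n\,m$ gates of $M$ whose operator $V$ satisfies $VE_n=E_nU$. -/

import Mathlib

namespace MatchgateUniversality

/-- Operators on `n` qubits, as matrices in the computational basis `|x_0 x_1 … x_{n-1}⟩`. -/
abbrev Gate (n : ℕ) : Type := Matrix (Fin n → Fin 2) (Fin n → Fin 2) ℂ

/-- The unitary operators on `n` qubits. -/
abbrev unitaries (n : ℕ) : Set (Gate n) := {U | U ∈ Matrix.unitaryGroup (Fin n → Fin 2) ℂ}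

/-- The parity-preserving two-qubit operator `G(A,B)`: it acts as `A` on the even subspace with
ordered basis `|00⟩, |11⟩` and as `B` on the odd subspace with ordered basis `|01⟩, |10⟩`.
In both cases the first bit of a basis vector is its index in the ordered basis. -/
def G (A B : Matrix (Fin 2) (Fin 2) ℂ) : Gate 2 := fun x y =>
  if x 0 = x 1 then
    if y 0 = y 1 then A (x 0) (y 0) else 0
  else
    if y 0 = y 1 then 0 else B (x 0) (y 0)

/-- The matchgates: the unitaries `G(C,D)` with `det C = det D`. -/
def matchgates : Set (Gate 2) :=
  {V | V ∈ unitaries 2 ∧ ∃ C D : Matrix (Fin 2) (Fin 2) ℂ, C.det = D.det ∧ V = G C D}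

/-- The `k`-qubit operator `U` applied to the qubits `f 0, …, f (k-1)` of an `n`-qubit register,
tensored with the identity on all other qubits. -/
def onQubits {k n : ℕ} (f : Fin k ↪ Fin n) (U : Gate k) : Gate n := fun x y =>
  if ∀ i, (∀ j, f j ≠ i) → x i = y i then U (x ∘ f) (y ∘ f) else 0

/-- The ordered pair of neighbouring qubits `(i, i+1)` of a line of `n` qubits. -/
def neighbours {n : ℕ} (i : ℕ) (h : i + 1 < n) : Fin 2 ↪ Fin n where
  toFun j := ⟨i + j, by omega⟩
  inj' a b hab := by
    have : i + (a : ℕ) = i + b := congrArg Fin.val hab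
    exact Fin.ext (by omega)

/-- The gates of `S` acting on nearest neighbours of a line of `n` qubits. -/
def nearestNeighbour (S : Set (Gate 2)) (n : ℕ) : Set (Gate n) :=
  {V | ∃ (i : ℕ) (h : i + 1 < n), ∃ U ∈ S, V = onQubits (neighbours i h) U}

/-- All one- and two-qubit unitaries acting on arbitrary (not necessarily neighbouring) qubits of
an `n`-qubit register. -/
def oneAndTwoQubit (n : ℕ) : Set (Gate n) :=
  {V | ∃ k : ℕ, 1 ≤ k ∧ k ≤ 2 ∧ ∃ f : Fin k ↪ Fin n, ∃ U ∈ unitaries k, V = onQubits f U}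

/-- A circuit with gates in `T`; the operator it performs is the product `C.prod`
and its size is `C.length`. -/
def IsCircuit {n : ℕ} (T : Set (Gate n)) (C : List (Gate n)) : Prop := ∀ V ∈ C, V ∈ T

/-- The isometry that encodes each logical qubit in two consecutive physical qubits by
`|0⟩ ↦ |00⟩`, `|1⟩ ↦ |11⟩`; logical qubit `j` sits on the physical qubits `2j` and `2j+1`. -/
def encoding (n : ℕ) : Matrix (Fin (n * 2) → Fin 2) (Fin n → Fin 2) ℂ := fun x y =>
  if ∀ i : Fin (n * 2), x i = y i.divNat then 1 else 0

/-- The physical operator `V` acts on encoded states exactly as the logical operator `U`. -/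
def Implements {n : ℕ} (V : Gate (n * 2)) (U : Gate n) : Prop :=
  V * encoding n = encoding n * U

/-- Encoded universality of the two-qubit gates `S` on a line of qubits with nearest-neighbour
action. First: every unitary on any positive number of logical qubits is performed by a finite
circuit. Second, efficiency: with a constant `K` that depends only on `S`, every logical circuit
of `m` one- and two-qubit gates, on any pairs among `n` logical qubits, is performed by a
nearest-neighbour circuit of at most `K * n * m` gates of `S`. -/
def EncodedUniversal (S : Set (Gate 2)) : Prop :=
  (∀ n : ℕ, 0 < n → ∀ U ∈ unitaries n,
    ∃ C, IsCircuit (nearestNeighbour S (n * 2)) C ∧ Implements C.prod U) ∧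
  ∃ K : ℕ, ∀ (n : ℕ) (L : List (Gate n)), IsCircuit (oneAndTwoQubit n) L →
    ∃ C, IsCircuit (nearestNeighbour S (n * 2)) C ∧ Implements C.prod L.prod ∧
      C.length ≤ K * n * L.length

end MatchgateUniversality

/-! An encoded pair lies in the even-parity subspace, and its two basis states are exactly the basis
on which the first block of a parity-preserving gate acts. So any one-qubit unitary `W` is a
matchgate on the pair: the odd block is never seen and only has to match the determinant
(`implements_G`, `G_det_mem_matchgates`). Matchgates also exchange neighbouring encoded qubits, by
four fermionic swaps whose signs cancel on encoded states (`implements_swap`). What is missing is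
one entangling gate. The non-matchgate, times a suitable matchgate, is the controlled phase with `w
= det A · conj (det B) ≠ 1` (`exists_matchgate_mul_eq_controlledPhase`); on the two adjacent qubits
of neighbouring pairs it is the same controlled phase on the logical qubits.

It remains to compile exactly, not approximately. The notion tracked is generation by words of
uniformly bounded length. Up to a phase on its control, the controlled phase is a controlled
noncentral element of `SU(2)`; conjugating by one-qubit gates on the target gives all controlled
conjugates. Boundedly many of these multiply to any element of `SU(2)`: the products of two
conjugates contain all elements with eigenvalues near 1, and every element is a bounded power of
such an element (`boundedlyGenerates_conjugates`).

Since every element of `SU(2)` is a commutator, controls can be intersected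
(`BoundedlyGenerates.controlledSU2_inter`). Fully controlled gates are two-level unitaries on
strings that differ in one bit; conjugation reaches all pairs of strings, column elimination gives
the special unitary group, and phases complete it (`boundedlyGenerates_unitaries`). For two qubits
this bounds the cost of any gate by a constant depending only on `w`; routing by swaps adds a factor
linear in `n`. The same result for `n` qubits gives the first claim. -/

namespace MatchgateUniversality

/-! ### Words of bounded length in a monoid -/

section Words

variable {M N : Type*} [Monoid M] [Monoid N]

/-- Some uniform `k` bounds the length of words in `T` needed to express the elements of `S`. -/
def BoundedlyGenerates (T S : Set M) : Prop :=
  ∃ k : ℕ, ∀ x ∈ S, ∃ l : List M, (∀ v ∈ l, v ∈ T) ∧ l.prod = x ∧ l.length ≤ k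

namespace BoundedlyGenerates

variable {T S S' R : Set M}

lemma of_subset (h : S ⊆ T) : BoundedlyGenerates T S :=
  ⟨1, fun x hx => ⟨[x], by simpa using h hx, by simp, by simp⟩⟩

lemma mono_right (h : BoundedlyGenerates T S) (hR : R ⊆ S) : BoundedlyGenerates T R := by
  obtain ⟨k, hk⟩ := h
  exact ⟨k, fun x hx => hk x (hR hx)⟩

/-- Substituting a word for each letter multiplies the length bounds. -/
lemma trans (h : BoundedlyGenerates T S) (h' : BoundedlyGenerates S R) :
    BoundedlyGenerates T R := by
  obtain ⟨k, hk⟩ := h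
  obtain ⟨m, hm⟩ := h'
  have key : ∀ l : List M, (∀ v ∈ l, v ∈ S) →
      ∃ l' : List M, (∀ v ∈ l', v ∈ T) ∧ l'.prod = l.prod ∧ l'.length ≤ k * l.length := by
    intro l
    induction l with
    | nil => intro _; exact ⟨[], by simp⟩
    | cons a l ih =>
      intro hl
      obtain ⟨l₁, h₁, p₁, c₁⟩ := hk a (hl a (by simp))
      obtain ⟨l₂, h₂, p₂, c₂⟩ := ih fun v hv => hl v (by simp [hv])
      refine ⟨l₁ ++ l₂, ?_, by simp [p₁, p₂], ?_⟩
      · intro v hv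
        rcases List.mem_append.1 hv with hv | hv
        exacts [h₁ v hv, h₂ v hv]
      · simp only [List.length_append, List.length_cons]
        nlinarith
  refine ⟨k * m, fun x hx => ?_⟩
  obtain ⟨l, hl, p, c⟩ := hm x hx
  obtain ⟨l', hl', p', c'⟩ := key l hl
  exact ⟨l', hl', p'.trans p, c'.trans (Nat.mul_le_mul_left k c)⟩

lemma union (h : BoundedlyGenerates T S) (h' : BoundedlyGenerates T S') :
    BoundedlyGenerates T (S ∪ S') := by
  obtain ⟨k, hk⟩ := h
  obtain ⟨m, hm⟩ := h'
  refine ⟨max k m, ?_⟩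
  rintro x (hx | hx)
  · obtain ⟨l, h1, h2, h3⟩ := hk x hx
    exact ⟨l, h1, h2, h3.trans (le_max_left _ _)⟩
  · obtain ⟨l, h1, h2, h3⟩ := hm x hx
    exact ⟨l, h1, h2, h3.trans (le_max_right _ _)⟩

lemma iUnion {ι : Type*} [Fintype ι] {S : ι → Set M} (h : ∀ i, BoundedlyGenerates T (S i)) :
    BoundedlyGenerates T (⋃ i, S i) := by
  choose k hk using h
  refine ⟨∑ i, k i, fun x hx => ?_⟩
  obtain ⟨i, hi⟩ := Set.mem_iUnion.1 hx
  obtain ⟨l, h1, h2, h3⟩ := hk i x hi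
  exact ⟨l, h1, h2, h3.trans (Finset.single_le_sum (fun _ _ => Nat.zero_le _)
    (Finset.mem_univ i))⟩

lemma words (h : BoundedlyGenerates T S) (k : ℕ)
    (hR : ∀ x ∈ R, ∃ l : List M, (∀ v ∈ l, v ∈ S) ∧ l.prod = x ∧ l.length ≤ k) :
    BoundedlyGenerates T R :=
  h.trans ⟨k, hR⟩

lemma one : BoundedlyGenerates T {1} :=
  ⟨0, by rintro _ rfl; exact ⟨[], by simp⟩⟩

lemma mul (h : BoundedlyGenerates T S) (h' : BoundedlyGenerates T S')
    (hR : ∀ x ∈ R, ∃ a ∈ S, ∃ b ∈ S', a * b = x) : BoundedlyGenerates T R := by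
  refine (h.union h').words 2 fun x hx => ?_
  obtain ⟨a, ha, b, hb, rfl⟩ := hR x hx
  refine ⟨[a, b], ?_, by simp, by simp⟩
  intro v hv
  simp only [List.mem_cons, List.not_mem_nil, or_false] at hv
  rcases hv with rfl | rfl
  exacts [Or.inl ha, Or.inr hb]

lemma image {T S : Set M} (h : BoundedlyGenerates T S) (φ : M →* N) :
    BoundedlyGenerates (φ '' T) (φ '' S) := by
  obtain ⟨k, hk⟩ := h
  refine ⟨k, ?_⟩
  rintro _ ⟨x, hx, rfl⟩
  obtain ⟨l, h1, h2, h3⟩ := hk x hx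
  refine ⟨l.map φ, ?_, by rw [← map_list_prod, h2], by simpa using h3⟩
  intro v hv
  obtain ⟨y, hy, rfl⟩ := List.mem_map.1 hv
  exact ⟨y, h1 y hy, rfl⟩

end BoundedlyGenerates

end Words

/-! ### Elementary facts on SU(2) and the Pauli matrix X -/

open Matrix ComplexConjugate

/-- The set `SU(2)`. -/
abbrev SU2 : Set (Matrix (Fin 2) (Fin 2) ℂ) := {W | W ∈ specialUnitaryGroup (Fin 2) ℂ}

lemma SU2.conjTranspose {W : Matrix (Fin 2) (Fin 2) ℂ} (hW : W ∈ SU2) : Wᴴ ∈ SU2 :=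
  (star (⟨W, hW⟩ : specialUnitaryGroup (Fin 2) ℂ)).2

lemma SU2.mul {V W : Matrix (Fin 2) (Fin 2) ℂ} (hV : V ∈ SU2) (hW : W ∈ SU2) : V * W ∈ SU2 :=
  (specialUnitaryGroup (Fin 2) ℂ).mul_mem hV hW

lemma SU2.conjTranspose_mul_self {W : Matrix (Fin 2) (Fin 2) ℂ} (hW : W ∈ SU2) : Wᴴ * W = 1 :=
  mem_unitaryGroup_iff'.1 (mem_specialUnitaryGroup_iff.1 hW).1

lemma SU2.mul_conjTranspose_self {W : Matrix (Fin 2) (Fin 2) ℂ} (hW : W ∈ SU2) : W * Wᴴ = 1 :=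
  mem_unitaryGroup_iff.1 (mem_specialUnitaryGroup_iff.1 hW).1

lemma mem_SU2_of_unit {p q : ℂ} (h : p * conj p + q * conj q = 1) :
    !![p, -conj q; q, conj p] ∈ SU2 := by
  refine mem_specialUnitaryGroup_iff.2 ⟨mem_unitaryGroup_iff'.2 ?_, ?_⟩
  · ext i j
    fin_cases i <;> fin_cases j <;>
      simp [Matrix.mul_apply, Fin.sum_univ_two, star_eq_conjTranspose] <;> grind
  · simp [det_fin_two]; grind

/-- Every vector of `ℂ²` is a multiple of the first column of an element of
`SU(2)`. -/
lemma exists_SU2_column (p q : ℂ) :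
    ∃ W ∈ SU2, ∃ r : ℂ, W 0 0 * r = p ∧ W 1 0 * r = q := by
  by_cases h0 : p * conj p + q * conj q = 0
  · have : p = 0 ∧ q = 0 := by
      rw [Complex.mul_conj, Complex.mul_conj] at h0
      have h1 : Complex.normSq p + Complex.normSq q = 0 := by exact_mod_cast h0
      have h2 := Complex.normSq_nonneg p
      have h3 := Complex.normSq_nonneg q
      exact ⟨Complex.normSq_eq_zero.1 (by linarith), Complex.normSq_eq_zero.1 (by linarith)⟩
    exact ⟨1, one_mem (specialUnitaryGroup (Fin 2) ℂ), 0, by simp [this]⟩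
  · set s : ℝ := Complex.normSq p + Complex.normSq q with hs
    have hs' : p * conj p + q * conj q = (s : ℂ) := by
      rw [Complex.mul_conj, Complex.mul_conj, hs]; push_cast; ring
    have hs0 : s ≠ 0 := by
      intro h; apply h0; rw [hs', h]; simp
    have hpos : 0 ≤ s := add_nonneg (Complex.normSq_nonneg p) (Complex.normSq_nonneg q)
    set r : ℝ := Real.sqrt s with hr
    have hrr : r * r = s := Real.mul_self_sqrt hpos
    have hr0 : (r : ℂ) ≠ 0 := by
      intro h
      have : r = 0 := by exact_mod_cast h
      apply hs0; rw [← hrr, this]; simp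
    have hrr' : (r : ℂ) * r = p * conj p + q * conj q := by rw [hs', ← hrr]; push_cast; ring
    refine ⟨!![p / r, -conj (q / r); q / r, conj (p / r)], mem_SU2_of_unit ?_, r, ?_, ?_⟩
    · simp only [map_div₀, Complex.conj_ofReal]
      field_simp
      rw [sq, hrr']
    · simp [hr0]
    · simp [hr0]

/-- The Pauli matrix `X`. -/
def pauliX : Matrix (Fin 2) (Fin 2) ℂ := !![0, 1; 1, 0]

lemma pauliX_mul_self : pauliX * pauliX = 1 := by
  ext a b; fin_cases a <;> fin_cases b <;> simp [pauliX]

lemma conjTranspose_pauliX : pauliXᴴ = pauliX := by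
  ext a b; fin_cases a <;> fin_cases b <;> simp [pauliX]

lemma pauliX_mem_unitaryGroup : pauliX ∈ unitaryGroup (Fin 2) ℂ := by
  rw [mem_unitaryGroup_iff, star_eq_conjTranspose, conjTranspose_pauliX, pauliX_mul_self]

lemma det_pauliX : pauliX.det = -1 := by simp [pauliX, det_fin_two]

/-! ### Two-level unitaries -/

section TwoLevel

set_option linter.unusedSectionVars false

variable {ι : Type*} [Fintype ι] [DecidableEq ι]

/-- The isometry from `ℂ²` onto the span of the basis vectors `i` and `j`. -/
def pairEmbedding (i j : ι) : Matrix ι (Fin 2) ℂ := 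
  of fun x => ![if x = i then 1 else 0, if x = j then 1 else 0]

/-- The two-level operator that acts as `W` on the span of the basis vectors `i`, `j` and as the
identity on the other basis vectors. -/
def twoLevel (i j : ι) (W : Matrix (Fin 2) (Fin 2) ℂ) : Matrix ι ι ℂ :=
  1 + pairEmbedding i j * (W - 1) * (pairEmbedding i j)ᴴ

lemma conjTranspose_pairEmbedding_apply (i j : ι) (b : Fin 2) (x : ι) :
    (pairEmbedding i j)ᴴ b x = pairEmbedding i j x b := by
  rw [conjTranspose_apply]
  fin_cases b <;> simp [pairEmbedding]

lemma pairEmbedding_isometry {i j : ι} (h : i ≠ j) :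
    (pairEmbedding i j)ᴴ * pairEmbedding i j = 1 := by
  ext a b
  simp only [Matrix.mul_apply, conjTranspose_pairEmbedding_apply]
  fin_cases a <;> fin_cases b <;> simp [pairEmbedding, h, h.symm]

lemma twoLevel_one (i j : ι) : twoLevel i j 1 = 1 := by simp [twoLevel]

lemma twoLevel_mul {i j : ι} (h : i ≠ j) (V W : Matrix (Fin 2) (Fin 2) ℂ) :
    twoLevel i j (V * W) = twoLevel i j V * twoLevel i j W := by
  have key : ∀ X Y : Matrix (Fin 2) (Fin 2) ℂ,
      pairEmbedding i j * X * (pairEmbedding i j)ᴴ * (pairEmbedding i j * Y * (pairEmbedding i j)ᴴ)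
        = pairEmbedding i j * (X * Y) * (pairEmbedding i j)ᴴ := by
    intro X Y
    calc _ = pairEmbedding i j * X * ((pairEmbedding i j)ᴴ * pairEmbedding i j) * Y
            * (pairEmbedding i j)ᴴ := by simp only [Matrix.mul_assoc]
      _ = _ := by rw [pairEmbedding_isometry h]; simp [Matrix.mul_assoc]
  have e : V * W - 1 = (V - 1) + (W - 1) + (V - 1) * (W - 1) := by noncomm_ring
  simp only [twoLevel]
  rw [e]
  simp only [Matrix.mul_add, Matrix.add_mul, key, Matrix.one_mul, Matrix.mul_one]
  abel

lemma twoLevel_conjTranspose (i j : ι) (W : Matrix (Fin 2) (Fin 2) ℂ) :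
    (twoLevel i j W)ᴴ = twoLevel i j Wᴴ := by
  simp [twoLevel, Matrix.mul_assoc]

lemma twoLevel_mem_unitaryGroup {i j : ι} (h : i ≠ j) {W : Matrix (Fin 2) (Fin 2) ℂ}
    (hW : W ∈ SU2) : twoLevel i j W ∈ unitaryGroup ι ℂ := by
  rw [mem_unitaryGroup_iff', star_eq_conjTranspose, twoLevel_conjTranspose, ← twoLevel_mul h,
    SU2.conjTranspose_mul_self hW, twoLevel_one]

lemma det_twoLevel {i j : ι} (h : i ≠ j) (W : Matrix (Fin 2) (Fin 2) ℂ) :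
    (twoLevel i j W).det = W.det := by
  rw [twoLevel, Matrix.mul_assoc, det_one_add_mul_comm, Matrix.mul_assoc,
    pairEmbedding_isometry h]
  simp

lemma twoLevel_mulVec {i j : ι} (h : i ≠ j) (W : Matrix (Fin 2) (Fin 2) ℂ) (v : ι → ℂ) (x : ι) :
    (twoLevel i j W *ᵥ v) x = if x = i then W 0 0 * v i + W 0 1 * v j else
      if x = j then W 1 0 * v i + W 1 1 * v j else v x := by
  have e0 : ((pairEmbedding i j)ᴴ *ᵥ v) = ![v i, v j] := by
    ext b
    simp only [mulVec, dotProduct, conjTranspose_pairEmbedding_apply]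
    fin_cases b <;> simp [pairEmbedding]
  rw [twoLevel, Matrix.add_mulVec, ← Matrix.mulVec_mulVec, ← Matrix.mulVec_mulVec, e0]
  simp only [mulVec, dotProduct, Fin.sum_univ_two, pairEmbedding, Pi.add_apply]
  by_cases hi : x = i
  · subst hi
    simp [h, Matrix.one_apply]; ring
  · by_cases hj : x = j
    · subst hj
      simp [hi, Matrix.one_apply]; ring
    · simp [hi, hj, Matrix.one_apply]

/-- The quarter turn on `j`, `k` fixes the basis vector `i` and takes `j` to `k`. Unlike the
transposition it has determinant 1, so it is itself a special two-level unitary. -/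
lemma twoLevel_conj_quarterTurn {i j k : ι} (hjk : j ≠ k) (hij : i ≠ j) (hik : i ≠ k)
    (W : Matrix (Fin 2) (Fin 2) ℂ) :
    twoLevel j k !![0, -1; 1, 0] * twoLevel i j W * (twoLevel j k !![0, -1; 1, 0])ᴴ
      = twoLevel i k W := by
  set J : Matrix (Fin 2) (Fin 2) ℂ := !![0, -1; 1, 0] with hJ
  have hJ' : J * Jᴴ = 1 := by
    ext a b; fin_cases a <;> fin_cases b <;> simp [hJ, Matrix.mul_apply]
  have e : twoLevel j k J * pairEmbedding i j = pairEmbedding i k := by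
    ext x b
    have : (twoLevel j k J * pairEmbedding i j) x b
      = (twoLevel j k J *ᵥ (fun y => pairEmbedding i j y b)) x := rfl
    rw [this, twoLevel_mulVec hjk]
    fin_cases b <;> simp [pairEmbedding, hJ] <;> grind
  have e' : (pairEmbedding i j)ᴴ * (twoLevel j k J)ᴴ = (pairEmbedding i k)ᴴ := by
    rw [← e, conjTranspose_mul]
  have h1 : twoLevel j k J * (twoLevel j k J)ᴴ = 1 := by
    rw [twoLevel_conjTranspose, ← twoLevel_mul hjk, hJ', twoLevel_one]
  rw [twoLevel.eq_1 i j, Matrix.mul_add, Matrix.add_mul, Matrix.mul_one, h1, twoLevel.eq_1 i k,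
    ← e', ← e]
  simp only [Matrix.mul_assoc]

lemma twoLevel_symm (i j : ι) (W : Matrix (Fin 2) (Fin 2) ℂ) :
    twoLevel j i W = twoLevel i j (pauliX * W * pauliX) := by
  have e : pairEmbedding j i = pairEmbedding i j * pauliX := by
    ext x b
    fin_cases b <;> simp [pairEmbedding, Matrix.mul_apply, pauliX]
  have h2 : pauliX * W * pauliX - 1 = pauliX * (W - 1) * pauliX := by
    rw [Matrix.mul_sub, Matrix.sub_mul, Matrix.mul_one, pauliX_mul_self]
  rw [twoLevel.eq_1 j i, twoLevel.eq_1 i j, h2, e, conjTranspose_mul, conjTranspose_pauliX]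
  simp only [Matrix.mul_assoc]

/-- The special two-level unitaries on the basis vectors `i`, `j`. -/
def specialTwoLevel (i j : ι) : Set (Matrix ι ι ℂ) := twoLevel i j '' SU2

lemma quarterTurn_mem_SU2 : (!![0, -1; 1, 0] : Matrix (Fin 2) (Fin 2) ℂ) ∈ SU2 := by
  simpa using mem_SU2_of_unit (p := 0) (q := 1) (by simp)

lemma specialTwoLevel_symm (i j : ι) : specialTwoLevel j i ⊆ specialTwoLevel i j := by
  rintro _ ⟨W, hW, rfl⟩
  obtain ⟨h1, h2⟩ := mem_specialUnitaryGroup_iff.1 hW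
  refine ⟨_, mem_specialUnitaryGroup_iff.2 ⟨
    mul_mem (mul_mem pauliX_mem_unitaryGroup h1) pauliX_mem_unitaryGroup, ?_⟩,
    (twoLevel_symm i j W).symm⟩
  rw [det_mul, det_mul, h2, det_pauliX]
  simp

lemma boundedlyGenerates_specialTwoLevel_trans {T : Set (Matrix ι ι ℂ)} {i j k : ι}
    (hjk : j ≠ k) (hij : i ≠ j) (hik : i ≠ k)
    (h1 : BoundedlyGenerates T (specialTwoLevel i j))
    (h2 : BoundedlyGenerates T (specialTwoLevel j k)) :
    BoundedlyGenerates T (specialTwoLevel i k) := by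
  refine (h1.union h2).words 3 ?_
  rintro _ ⟨W, hW, rfl⟩
  refine ⟨[twoLevel j k !![0, -1; 1, 0], twoLevel i j W, (twoLevel j k !![0, -1; 1, 0])ᴴ],
    ?_, ?_, by simp⟩
  · intro v hv
    simp only [List.mem_cons, List.not_mem_nil, or_false] at hv
    rcases hv with rfl | rfl | rfl
    · exact Or.inr ⟨_, quarterTurn_mem_SU2, rfl⟩
    · exact Or.inl ⟨_, hW, rfl⟩
    · exact Or.inr ⟨_, SU2.conjTranspose quarterTurn_mem_SU2, (twoLevel_conjTranspose _ _ _).symm⟩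
  · rw [← twoLevel_conj_quarterTurn hjk hij hik]
    simp [Matrix.mul_assoc]

end TwoLevel

/-! ### Generating the unitary group by column elimination -/

section Elimination

variable {ι : Type*} [Fintype ι] [DecidableEq ι]

/-- A product of special two-level unitaries takes a multiple of a basis vector to any vector
supported on that basis vector and a set `s`. -/
lemma exists_word_specialTwoLevel_mulVec (a : ι) (s : Finset ι) (ha : a ∉ s) :
    ∀ v : ι → ℂ, (∀ x, x ≠ a → x ∉ s → v x = 0) →
      ∃ l : List (Matrix ι ι ℂ), (∀ H ∈ l, ∃ j ∈ s, H ∈ specialTwoLevel a j) ∧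
        l.length ≤ s.card ∧ ∃ c : ℂ, v = l.prod *ᵥ Pi.single a c := by
  induction s using Finset.induction_on with
  | empty =>
    intro v hv
    refine ⟨[], by simp, by simp, v a, ?_⟩
    ext x
    by_cases hx : x = a
    · subst hx; simp
    · simp [hx, hv x hx]
  | insert j s hj ih =>
    intro v hv
    have haj : a ≠ j := fun h => ha (by simp [h])
    obtain ⟨W, hW, r, h0, h1⟩ := exists_SU2_column (v a) (v j)
    -- One rotation merges coordinate `j` into coordinate `a`, which leaves a vector supported on
    -- `a` and the smaller set.
    set v' : ι → ℂ := Function.update (Function.update v j 0) a r with hv'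
    have hvv : v = twoLevel a j W *ᵥ v' := by
      ext x
      rw [twoLevel_mulVec haj]
      by_cases hx : x = a
      · subst hx; simp [hv', haj.symm, h0]
      · by_cases hx' : x = j
        · subst hx'; simp [hv', hx, h1]
        · simp [hv', hx, hx']
    obtain ⟨l, hl, hc, c, e⟩ := ih (fun h => ha (by simp [h])) v' (by
      intro x hx hxs
      by_cases hx' : x = j
      · subst hx'; simp [hv', hx]
      · simp [hv', hx, hx', hv x hx (by simp [hx', hxs])])
    refine ⟨twoLevel a j W :: l, ?_, ?_, c, ?_⟩
    · intro H hH
      rcases List.mem_cons.1 hH with rfl | hH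
      · exact ⟨j, by simp, W, hW, rfl⟩
      · obtain ⟨k, hk, hk'⟩ := hl H hH
        exact ⟨k, by simp [hk], hk'⟩
    · simp [Finset.card_insert_of_notMem hj, hc]
    · rw [List.prod_cons, ← Matrix.mulVec_mulVec, ← e, ← hvv]

/-- The special unitaries that fix the basis vectors outside `s`. -/
def specialUnitaryFixing (s : Finset ι) : Set (Matrix ι ι ℂ) :=
  {U | U ∈ specialUnitaryGroup ι ℂ ∧ ∀ i, i ∉ s → U *ᵥ Pi.single i 1 = Pi.single i 1}

lemma eq_one_of_mulVec_single {U : Matrix ι ι ℂ} (h : ∀ i, U *ᵥ Pi.single i 1 = Pi.single i 1) :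
    U = 1 := by
  ext x y
  have := congrFun (h y) x
  simpa [Matrix.one_apply, Pi.single_apply] using this

lemma twoLevel_mem_specialUnitaryGroup {i j : ι} (h : i ≠ j) {W : Matrix (Fin 2) (Fin 2) ℂ}
    (hW : W ∈ SU2) : twoLevel i j W ∈ specialUnitaryGroup ι ℂ :=
  mem_specialUnitaryGroup_iff.2 ⟨twoLevel_mem_unitaryGroup h hW,
    (det_twoLevel h W).trans (mem_specialUnitaryGroup_iff.1 hW).2⟩

lemma specialTwoLevel_subset_fixing {a j : ι} (haj : a ≠ j) {s : Finset ι} (ha : a ∈ s)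
    (hj : j ∈ s) : specialTwoLevel a j ⊆ specialUnitaryFixing s := by
  rintro _ ⟨W, hW, rfl⟩
  refine ⟨twoLevel_mem_specialUnitaryGroup haj hW, fun i hi => ?_⟩
  have hia : i ≠ a := fun h => hi (h ▸ ha)
  have hij : i ≠ j := fun h => hi (h ▸ hj)
  ext x
  rw [twoLevel_mulVec haj]
  by_cases hx : x = a
  · subst hx; simp [hia.symm, hij.symm]
  · by_cases hx' : x = j
    · subst hx'; simp [hia.symm, hij.symm]
    · simp [hx, hx']

lemma specialUnitaryFixing_mul {s : Finset ι} {U V : Matrix ι ι ℂ}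
    (hU : U ∈ specialUnitaryFixing s) (hV : V ∈ specialUnitaryFixing s) :
    U * V ∈ specialUnitaryFixing s :=
  ⟨(specialUnitaryGroup ι ℂ).mul_mem hU.1 hV.1, fun i hi => by
    rw [← Matrix.mulVec_mulVec, hV.2 i hi, hU.2 i hi]⟩

lemma specialUnitaryFixing_conjTranspose {s : Finset ι} {U : Matrix ι ι ℂ}
    (hU : U ∈ specialUnitaryFixing s) : Uᴴ ∈ specialUnitaryFixing s := by
  refine ⟨(star (⟨U, hU.1⟩ : specialUnitaryGroup ι ℂ)).2, fun i hi => ?_⟩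
  have h : Uᴴ * U = 1 := mem_unitaryGroup_iff'.1 (mem_specialUnitaryGroup_iff.1 hU.1).1
  conv_lhs => rw [← hU.2 i hi]
  rw [Matrix.mulVec_mulVec, h, Matrix.one_mulVec]

lemma specialUnitaryFixing_list_prod {s : Finset ι} (l : List (Matrix ι ι ℂ))
    (h : ∀ H ∈ l, H ∈ specialUnitaryFixing s) : l.prod ∈ specialUnitaryFixing s := by
  induction l with
  | nil => exact ⟨one_mem _, fun i _ => Matrix.one_mulVec _⟩
  | cons a l ih =>
    rw [List.prod_cons]
    exact specialUnitaryFixing_mul (h a (by simp)) (ih fun H hH => h H (by simp [hH]))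

/-- The adjoint fixes the basis vector `x` too, so the `x` coordinate of the image of `a` is the
inner product of two distinct basis vectors. -/
lemma specialUnitaryFixing_apply_eq_zero {s : Finset ι} {U : Matrix ι ι ℂ}
    (hU : U ∈ specialUnitaryFixing s) {a x : ι} (hxa : x ≠ a) (hx : x ∉ s) :
    (U *ᵥ Pi.single a 1) x = 0 := by
  have h := congrFun ((specialUnitaryFixing_conjTranspose hU).2 x hx) a
  simp only [mulVec_single_one, col_apply, conjTranspose_apply, RCLike.star_def,
    Pi.single_apply, hxa.symm, if_false, map_eq_zero] at h
  simpa using h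

/-- Special two-level unitaries on all pairs of basis vectors generate the special unitary group
with words of bounded length. -/
lemma boundedlyGenerates_specialUnitaryFixing {T : Set (Matrix ι ι ℂ)}
    (hT : ∀ i j : ι, i ≠ j → BoundedlyGenerates T (specialTwoLevel i j)) (s : Finset ι) :
    BoundedlyGenerates T (specialUnitaryFixing s) := by
  induction s using Finset.induction_on with
  | empty =>
    refine BoundedlyGenerates.one.mono_right fun U hU => ?_
    exact eq_one_of_mulVec_single fun i => hU.2 i (by simp)
  | insert a s ha ih =>
    rcases s.eq_empty_or_nonempty with rfl | ⟨j, hj⟩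
    -- With only `a` free, `U` is diagonal with one possibly nontrivial entry, which equals the
    -- determinant, hence 1.
    · refine BoundedlyGenerates.one.mono_right fun U hU => ?_
      have hd : U = diagonal fun i => U i i := by
        ext x y
        by_cases hxy : x = y
        · subst hxy; simp
        · rw [diagonal_apply_ne _ hxy]
          by_cases hy : y = a
          · subst hy
            simpa using specialUnitaryFixing_apply_eq_zero hU hxy (by simpa using hxy)
          · simpa [hxy] using congrFun (hU.2 y (by simpa using hy)) x
      have hne : ∀ i, i ≠ a → U i i = 1 := fun i hi => by
        simpa using congrFun (hU.2 i (by simpa using hi)) i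
      have hdet := (mem_specialUnitaryGroup_iff.1 hU.1).2
      rw [hd, det_diagonal, Finset.prod_eq_single a (fun i _ hi => hne i hi) (by simp)] at hdet
      rw [Set.mem_singleton_iff, hd, ← diagonal_one]
      congr 1
      ext i
      by_cases hi : i = a
      · rw [hi, hdet]
      · exact hne i hi
    · have haj : a ≠ j := fun h => ha (h ▸ hj)
      have hpairs : BoundedlyGenerates T (⋃ k : s, specialTwoLevel a (k : ι)) :=
        BoundedlyGenerates.iUnion fun k => hT a k fun h => ha (h ▸ k.2)
      refine (hpairs.words (R := {H | ∃ l : List (Matrix ι ι ℂ),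
        (∀ v ∈ l, v ∈ ⋃ k : s, specialTwoLevel a (k : ι)) ∧ l.prod = H ∧
          l.length ≤ s.card + 1}) (s.card + 1) fun x hx => hx).mul ih fun U hU => ?_
      obtain ⟨l, hl, hlen, c, hc⟩ := exists_word_specialTwoLevel_mulVec a s ha
        (U *ᵥ Pi.single a 1) fun x hx hxs =>
          specialUnitaryFixing_apply_eq_zero hU hx (by simp [hx, hxs])
      have hlfix : l.prod ∈ specialUnitaryFixing (insert a s) :=
        specialUnitaryFixing_list_prod l fun H hH => by
          obtain ⟨k, hk, hk'⟩ := hl H hH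
          exact specialTwoLevel_subset_fixing (s := insert a s) (fun h : a = k => ha (h ▸ hk))
            (by simp) (by simp [hk]) hk'
      have hl1 : l.prodᴴ * l.prod = 1 :=
        mem_unitaryGroup_iff'.1 (mem_specialUnitaryGroup_iff.1 hlfix.1).1
      have hU' := specialUnitaryFixing_mul (specialUnitaryFixing_conjTranspose hlfix) hU
      have hcol : (l.prodᴴ * U) *ᵥ Pi.single a 1 = Pi.single a c := by
        rw [← Matrix.mulVec_mulVec, hc, Matrix.mulVec_mulVec, hl1, Matrix.one_mulVec]
      have hcc : c * star c + 0 * star 0 = 1 := by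
        have h1 : (l.prodᴴ * U)ᴴ * (l.prodᴴ * U) = 1 :=
          mem_unitaryGroup_iff'.1 (mem_specialUnitaryGroup_iff.1 hU'.1).1
        have h2 := congrFun (congrFun h1 a) a
        have h3 : ∀ x, (l.prodᴴ * U) x a = Pi.single (M := fun _ => ℂ) a c x := fun x => by
          rw [← hcol]; simp
        rw [Matrix.mul_apply] at h2
        simp only [conjTranspose_apply, h3, Matrix.one_apply_eq] at h2
        rw [Finset.sum_eq_single a (by intro b _ hb; simp [hb]) (by simp)] at h2
        simp only [Pi.single_eq_same] at h2
        rw [mul_comm] at h2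
        simpa using h2
      -- Elimination leaves a phase `c` at `a`. It is moved to another free basis vector `j`, so
      -- that the correction keeps determinant 1.
      set W : Matrix (Fin 2) (Fin 2) ℂ := !![c, -star 0; 0, star c] with hW
      have hWmem : W ∈ SU2 := mem_SU2_of_unit hcc
      have hDfix : twoLevel a j W ∈ specialUnitaryFixing (insert a s) :=
        specialTwoLevel_subset_fixing haj (by simp) (by simp [hj]) ⟨W, hWmem, rfl⟩
      have hD1 : (twoLevel a j W)ᴴ * twoLevel a j W = 1 :=
        mem_unitaryGroup_iff'.1 (mem_specialUnitaryGroup_iff.1 hDfix.1).1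
      have hD2 : twoLevel a j W * (twoLevel a j W)ᴴ = 1 :=
        mem_unitaryGroup_iff.1 (mem_specialUnitaryGroup_iff.1 hDfix.1).1
      have hl2 : l.prod * l.prodᴴ = 1 :=
        mem_unitaryGroup_iff.1 (mem_specialUnitaryGroup_iff.1 hlfix.1).1
      have hDa : twoLevel a j W *ᵥ Pi.single a 1 = Pi.single a c := by
        ext x
        rw [twoLevel_mulVec haj]
        by_cases hx : x = a
        · subst hx; simp [hW, haj.symm]
        · by_cases hx' : x = j
          · subst hx'; simp [hx, hW]
          · simp [hx, hx']
      refine ⟨l.prod * twoLevel a j W, ⟨l ++ [twoLevel a j W], ?_, by simp, by simpa using hlen⟩,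
        (twoLevel a j W)ᴴ * (l.prodᴴ * U), ?_, ?_⟩
      · intro H hH
        rcases List.mem_append.1 hH with hH | hH
        · obtain ⟨k, hk, hk'⟩ := hl H hH
          exact Set.mem_iUnion.2 ⟨⟨k, hk⟩, hk'⟩
        · rw [List.mem_singleton.1 hH]
          exact Set.mem_iUnion.2 ⟨⟨j, hj⟩, W, hWmem, rfl⟩
      · have h := specialUnitaryFixing_mul (specialUnitaryFixing_conjTranspose hDfix) hU'
        refine ⟨h.1, fun i hi => ?_⟩
        by_cases hia : i = a
        · subst hia
          rw [← Matrix.mulVec_mulVec, hcol, ← hDa, Matrix.mulVec_mulVec, hD1, Matrix.one_mulVec]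
        · exact h.2 i (by simp [hia, hi])
      · calc _ = l.prod * (twoLevel a j W * (twoLevel a j W)ᴴ) * l.prodᴴ * U := by
              simp only [Matrix.mul_assoc]
          _ = U := by rw [hD2, Matrix.mul_one, hl2, Matrix.one_mul]

/-- Special two-level unitaries together with the phases generate the unitary group with words of
bounded length. -/
lemma boundedlyGenerates_unitaryGroup [Nonempty ι] {T : Set (Matrix ι ι ℂ)}
    (hT : ∀ i j : ι, i ≠ j → BoundedlyGenerates T (specialTwoLevel i j))
    (hphase : BoundedlyGenerates T {V | ∃ z : ℂ, ‖z‖ = 1 ∧ V = z • 1}) :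
    BoundedlyGenerates T {U | U ∈ unitaryGroup ι ℂ} := by
  refine hphase.mul (boundedlyGenerates_specialUnitaryFixing hT Finset.univ) fun U hU => ?_
  have hn : Fintype.card ι ≠ 0 := Fintype.card_ne_zero
  -- Dividing by a root of the determinant, of order the dimension, makes `U` special.
  obtain ⟨z, hz⟩ := IsAlgClosed.exists_pow_nat_eq U.det (Nat.pos_of_ne_zero hn)
  have hz1 : ‖z‖ = 1 := by
    have hd : ‖U.det‖ = 1 := by
      have := Matrix.det_of_mem_unitary hU
      exact CStarRing.norm_of_mem_unitary this
    rw [← hz, norm_pow] at hd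
    exact (pow_eq_one_iff_of_nonneg (norm_nonneg z) hn).1 hd
  have hz0 : z ≠ 0 := fun h => by simp [h] at hz1
  have hzz : star z⁻¹ * z⁻¹ = 1 := by
    have := Complex.conj_mul' z⁻¹
    rw [norm_inv, hz1] at this
    simpa using this
  refine ⟨z • 1, ⟨z, hz1, rfl⟩, z⁻¹ • U, ⟨mem_specialUnitaryGroup_iff.2 ⟨?_, ?_⟩, by simp⟩, ?_⟩
  · rw [mem_unitaryGroup_iff', star_smul, smul_mul_smul_comm, hzz, mem_unitaryGroup_iff'.1 hU,
      one_smul]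
  · rw [det_smul, ← hz, inv_pow, inv_mul_cancel₀ (pow_ne_zero _ hz0)]
  · rw [smul_mul_smul_comm, mul_inv_cancel₀ hz0, Matrix.one_mul, one_smul]

end Elimination

/-! ### Commutators and products of conjugates in SU(2) -/

section SpecialUnitaryTwo

/-- The diagonal matrix with entries `z` and its conjugate. -/
def conjDiagonal (z : ℂ) : Matrix (Fin 2) (Fin 2) ℂ := !![z, 0; 0, conj z]

lemma mul_conj_of_norm_eq_one {z : ℂ} (hz : ‖z‖ = 1) : z * conj z = 1 := by
  rw [Complex.mul_conj']; simp [hz]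

lemma conjDiagonal_mem {z : ℂ} (hz : ‖z‖ = 1) : conjDiagonal z ∈ SU2 := by
  have := mem_SU2_of_unit (p := z) (q := 0) (by simp [mul_conj_of_norm_eq_one hz])
  simpa [conjDiagonal] using this

lemma conjDiagonal_mul (y z : ℂ) :
    conjDiagonal y * conjDiagonal z = conjDiagonal (y * z) := by
  simp [conjDiagonal]

/-- The quarter turn exchanges the two eigenlines. -/
lemma conjDiagonal_conj (z : ℂ) :
    conjDiagonal (conj z) = !![0, -1; 1, 0] * conjDiagonal z * (!![0, -1; 1, 0])ᴴ := by
  ext i j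
  fin_cases i <;> fin_cases j <;> simp [conjDiagonal, Matrix.mul_apply, Fin.sum_univ_two]

/-- Diagonalization in `SU(2)`. -/
lemma exists_conjDiagonal {W : Matrix (Fin 2) (Fin 2) ℂ} (hW : W ∈ SU2) :
    ∃ V ∈ SU2, ∃ z : ℂ, ‖z‖ = 1 ∧ W = V * conjDiagonal z * Vᴴ := by
  obtain ⟨s, hs⟩ := IsAlgClosed.exists_pow_nat_eq (W.trace ^ 2 - 4 * W.det) (n := 2) (by norm_num)
  -- An eigenvalue from the quadratic formula. In a basis starting with a unit eigenvector, the
  -- first column of the matrix is `(ev, 0)`, and unitarity kills the other off-diagonal entry.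
  set ev : ℂ := (W.trace + s) / 2 with hev
  have hroot : (W - ev • (1 : Matrix (Fin 2) (Fin 2) ℂ)).det = 0 := by
    simp only [det_fin_two, trace_fin_two] at hs ⊢
    simp [hev, trace_fin_two]
    grind
  obtain ⟨v, hv0, hv⟩ := Matrix.exists_mulVec_eq_zero_iff.2 hroot
  obtain ⟨V, hV, r, h0, h1⟩ := exists_SU2_column (v 0) (v 1)
  have hr : r ≠ 0 := by
    rintro rfl
    apply hv0
    ext i
    fin_cases i
    · simpa using h0.symm
    · simpa using h1.symm
  have e0 := congrFun hv 0
  have e1 := congrFun hv 1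
  simp only [mulVec, dotProduct, Fin.sum_univ_two, ← h0, ← h1, Matrix.sub_apply,
    Matrix.smul_apply, Pi.zero_apply] at e0 e1
  have c0 : W 0 0 * V 0 0 + W 0 1 * V 1 0 = ev * V 0 0 := by
    apply mul_right_cancel₀ hr
    simp at e0
    linear_combination e0
  have c1 : W 1 0 * V 0 0 + W 1 1 * V 1 0 = ev * V 1 0 := by
    apply mul_right_cancel₀ hr
    simp at e1
    linear_combination e1
  set D := Vᴴ * W * V with hD
  have hDmem : D ∈ SU2 := SU2.mul (SU2.mul (SU2.conjTranspose hV) hW) hV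
  have hVV := SU2.conjTranspose_mul_self hV
  have f0 := congrFun (congrFun hVV 0) 0
  have f1 := congrFun (congrFun hVV 1) 0
  simp only [Matrix.mul_apply, Fin.sum_univ_two] at f0 f1
  have d0 : D 0 0 = ev := by
    rw [hD, Matrix.mul_assoc]
    simp only [Matrix.mul_apply, Fin.sum_univ_two, c0, c1]
    simp at f0 ⊢
    linear_combination ev * f0
  have d1 : D 1 0 = 0 := by
    rw [hD, Matrix.mul_assoc]
    simp only [Matrix.mul_apply, Fin.sum_univ_two, c0, c1]
    simp at f1 ⊢
    linear_combination ev * f1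
  have hDD := SU2.conjTranspose_mul_self hDmem
  have g0 := congrFun (congrFun hDD 0) 0
  have g1 := congrFun (congrFun hDD 0) 1
  simp only [Matrix.mul_apply, Fin.sum_univ_two, conjTranspose_apply, d0, d1] at g0 g1
  simp at g0 g1
  have hev0 : ev ≠ 0 := by rintro h; simp [h] at g0
  have hdet := (mem_specialUnitaryGroup_iff.1 hDmem).2
  rw [det_fin_two, d0, d1] at hdet
  have g1' : D 0 1 = 0 := by simpa [hev0] using g1
  have hD' : D = conjDiagonal ev := by
    ext i j
    fin_cases i <;> fin_cases j <;> simp [conjDiagonal, d0, d1, g1']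
    apply mul_left_cancel₀ hev0
    linear_combination hdet - g0
  refine ⟨V, hV, ev, ?_, ?_⟩
  · have := Complex.conj_mul' ev
    rw [g0] at this
    have h2 : ‖ev‖ ^ 2 = 1 := by exact_mod_cast this.symm
    exact (pow_eq_one_iff_of_nonneg (norm_nonneg _) two_ne_zero).1 h2
  · have hVV' := SU2.mul_conjTranspose_self hV
    calc W = (V * Vᴴ) * W * (V * Vᴴ) := by rw [hVV']; simp
      _ = _ := by rw [← hD', hD]; simp only [Matrix.mul_assoc]

/-- Every element of `SU(2)` is a commutator. -/
lemma exists_commutator {W : Matrix (Fin 2) (Fin 2) ℂ} (hW : W ∈ SU2) :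
    ∃ g ∈ SU2, ∃ h ∈ SU2, W = g * h * gᴴ * hᴴ := by
  obtain ⟨V, hV, z, hz, rfl⟩ := exists_conjDiagonal hW
  obtain ⟨y, rfl⟩ := IsAlgClosed.exists_pow_nat_eq z (n := 2) (by norm_num)
  have hy : ‖y‖ = 1 := by
    rw [norm_pow] at hz
    exact (pow_eq_one_iff_of_nonneg (norm_nonneg _) two_ne_zero).1 hz
  have hVV := SU2.conjTranspose_mul_self hV
  -- In the eigenbasis, the quarter turn conjugates the inverse of the diagonal element back to that
  -- element, so their commutator is its square; hence the square root `y`.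
  refine ⟨V * conjDiagonal y * Vᴴ, SU2.mul (SU2.mul hV (conjDiagonal_mem hy))
    (SU2.conjTranspose hV), V * !![0, -1; 1, 0] * Vᴴ,
    SU2.mul (SU2.mul hV quarterTurn_mem_SU2) (SU2.conjTranspose hV), ?_⟩
  have hconj : (conjDiagonal y)ᴴ = conjDiagonal (conj y) := by
    ext i j; fin_cases i <;> fin_cases j <;> simp [conjDiagonal]
  have key : conjDiagonal (y ^ 2) = conjDiagonal y * !![0, -1; 1, 0] * (conjDiagonal y)ᴴ *
      (!![0, -1; 1, 0])ᴴ := by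
    have := conjDiagonal_conj (conj y)
    rw [Complex.conj_conj] at this
    rw [hconj, Matrix.mul_assoc, Matrix.mul_assoc, ← Matrix.mul_assoc !![0, -1; 1, 0], ← this,
      conjDiagonal_mul, sq]
  have cancel : ∀ X : Matrix (Fin 2) (Fin 2) ℂ, Vᴴ * (V * X) = X := fun X => by
    rw [← Matrix.mul_assoc, hVV, Matrix.one_mul]
  rw [key]
  simp only [conjTranspose_mul, conjTranspose_conjTranspose, Matrix.mul_assoc, cancel]

/-- The conjugates of `g` under `SU(2)`. -/
def conjugates (g : Matrix (Fin 2) (Fin 2) ℂ) : Set (Matrix (Fin 2) (Fin 2) ℂ) :=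
  {h | ∃ V ∈ SU2, h = V * g * Vᴴ}

/-- For a real rotation `V` with squared cosine `t`, the trace is `2 (t Re u² + 1 - t)`. It moves
linearly from 2 to `2 Re u²` as `t` runs from 0 to 1; the chosen `t` solves for `c`. -/
lemma exists_trace_eq {u : ℂ} (hu : ‖u‖ = 1) {c : ℝ} (h1 : (u ^ 2).re ≤ c) (h2 : c ≤ 1)
    (hne : (u ^ 2).re < 1) :
    ∃ V ∈ SU2, (conjDiagonal u * (V * conjDiagonal u * Vᴴ)).trace = 2 * c := by
  set t : ℝ := (1 - c) / (1 - (u ^ 2).re) with ht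
  have hpos : 0 < 1 - (u ^ 2).re := by linarith
  have ht0 : 0 ≤ t := div_nonneg (by linarith) hpos.le
  have ht1 : t ≤ 1 := (div_le_one hpos).2 (by linarith)
  have hte : t * (1 - (u ^ 2).re) = 1 - c := div_mul_cancel₀ _ hpos.ne'
  set p : ℝ := Real.sqrt t
  set q : ℝ := Real.sqrt (1 - t)
  have hp : p * p = t := Real.mul_self_sqrt ht0
  have hq : q * q = 1 - t := Real.mul_self_sqrt (by linarith)
  have hp' : (p : ℂ) * p = t := by exact_mod_cast hp
  have hq' : (q : ℂ) * q = 1 - t := by exact_mod_cast hq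
  refine ⟨!![(p : ℂ), -conj (q : ℂ); (q : ℂ), conj (p : ℂ)], mem_SU2_of_unit ?_, ?_⟩
  · simp [hp', hq']
  · have huu := mul_conj_of_norm_eq_one hu
    have hre : u ^ 2 + conj u ^ 2 = 2 * ((u ^ 2).re : ℂ) := by
      rw [← map_pow, Complex.add_conj]; push_cast; ring
    have hte' : (t : ℂ) * (1 - ((u ^ 2).re : ℂ)) = 1 - c := by exact_mod_cast hte
    simp only [trace_fin_two, conjDiagonal, Matrix.mul_apply, Fin.sum_univ_two,
      conjTranspose_apply]
    simp
    linear_combination (u ^ 2 + conj u ^ 2) * hp' + 2 * (u * conj u) * hq' +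
      t * hre + 2 * (1 - t) * huu - 2 * hte'

/-- This is why the trace determines the conjugacy class in `SU(2)`: it fixes the eigenvalue up to
conjugation. -/
lemma eq_or_eq_conj_of_re_eq {y z : ℂ} (hy : ‖y‖ = 1) (hz : ‖z‖ = 1) (h : y.re = z.re) :
    y = z ∨ y = conj z := by
  have h1 : y.re * y.re + y.im * y.im = 1 := by
    rw [← Complex.normSq_apply, Complex.normSq_eq_norm_sq, hy]; simp
  have h2 : z.re * z.re + z.im * z.im = 1 := by
    rw [← Complex.normSq_apply, Complex.normSq_eq_norm_sq, hz]; simp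
  have h3 : (y.im - z.im) * (y.im + z.im) = 0 := by rw [h] at h1; linarith
  rcases mul_eq_zero.1 h3 with h3 | h3
  · exact Or.inl (Complex.ext h (by linarith))
  · exact Or.inr (Complex.ext (by simpa using h) (by simp; linarith))

lemma conj_mem_conjugates {g h V : Matrix (Fin 2) (Fin 2) ℂ}
    (hh : h ∈ conjugates g) (hV : V ∈ SU2) : V * h * Vᴴ ∈ conjugates g := by
  obtain ⟨Y, hY, rfl⟩ := hh
  exact ⟨V * Y, SU2.mul hV hY, by simp only [conjTranspose_mul, Matrix.mul_assoc]⟩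

/-- A product of two conjugates can be given the trace `2 Re y`. It is then conjugate to the target,
and the conjugation can be distributed over the two factors. -/
lemma exists_conjugates_mul_eq {u y : ℂ} (hu : ‖u‖ = 1) (hne : (u ^ 2).re < 1) (hy : ‖y‖ = 1)
    (hre : (u ^ 2).re ≤ y.re) :
    ∃ g ∈ conjugates (conjDiagonal u), ∃ h ∈ conjugates (conjDiagonal u),
      conjDiagonal y = g * h := by
  have hy1 : y.re ≤ 1 := (Complex.re_le_norm y).trans hy.le
  obtain ⟨V, hV, htr⟩ := exists_trace_eq hu hre hy1 hne
  set P := conjDiagonal u * (V * conjDiagonal u * Vᴴ) with hP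
  have hPmem : P ∈ SU2 := SU2.mul (conjDiagonal_mem hu)
    (SU2.mul (SU2.mul hV (conjDiagonal_mem hu)) (SU2.conjTranspose hV))
  obtain ⟨Y, hY, z, hz, hPY⟩ := exists_conjDiagonal hPmem
  have hYY := SU2.conjTranspose_mul_self hY
  have hYY' := SU2.mul_conjTranspose_self hY
  have hzr : z.re = y.re := by
    rw [hPY, trace_mul_comm, ← Matrix.mul_assoc, hYY, Matrix.one_mul, trace_fin_two] at htr
    simp only [conjDiagonal, of_apply, cons_val', cons_val_zero, cons_val_one,
      cons_val_fin_one] at htr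
    rw [Complex.add_conj] at htr
    have h : 2 * z.re = 2 * y.re := by exact_mod_cast htr
    linarith
  have hz' : conjDiagonal z = Yᴴ * P * Y := by
    rw [hPY]
    calc conjDiagonal z = (Yᴴ * Y) * conjDiagonal z * (Yᴴ * Y) := by rw [hYY]; simp
      _ = _ := by simp only [Matrix.mul_assoc]
  have main : ∃ X ∈ SU2, conjDiagonal y = X * P * Xᴴ := by
    rcases eq_or_eq_conj_of_re_eq hy hz hzr.symm with h | h
    · exact ⟨Yᴴ, SU2.conjTranspose hY, by rw [h, hz', conjTranspose_conjTranspose]⟩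
    · refine ⟨!![0, -1; 1, 0] * Yᴴ, SU2.mul quarterTurn_mem_SU2 (SU2.conjTranspose hY), ?_⟩
      rw [h, conjDiagonal_conj, hz', conjTranspose_mul, conjTranspose_conjTranspose]
      simp only [Matrix.mul_assoc]
  obtain ⟨X, hX, hXP⟩ := main
  have hXX := SU2.conjTranspose_mul_self hX
  refine ⟨X * conjDiagonal u * Xᴴ, ⟨X, hX, rfl⟩, X * (V * conjDiagonal u * Vᴴ) * Xᴴ,
    conj_mem_conjugates ⟨V, hV, rfl⟩ hX, ?_⟩
  have cancel : ∀ Z : Matrix (Fin 2) (Fin 2) ℂ, Xᴴ * (X * Z) = Z := fun Z => by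
    rw [← Matrix.mul_assoc, hXX, Matrix.one_mul]
  rw [hXP, hP]
  simp only [Matrix.mul_assoc, cancel]

/-- Roots of bounded order of all points of the circle lie in a given neighbourhood of `1`. -/
lemma exists_root_near_one {c : ℝ} (hc : c < 1) :
    ∃ N : ℕ, ∀ z : ℂ, ‖z‖ = 1 → ∃ y : ℂ, ‖y‖ = 1 ∧ y ^ N = z ∧ c ≤ y.re := by
  -- The root has argument at most `π / N` in size, and `cos x ≥ 1 - x² / 2`; as `N ≥ 1`, a bound on
  -- `N` serves for `N²`.
  obtain ⟨N, hN⟩ := exists_nat_gt (Real.pi ^ 2 / (1 - c))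
  have hN0 : 0 < (N : ℝ) := lt_of_le_of_lt (div_nonneg (sq_nonneg _) (by linarith)) hN
  have hN1 : (1 : ℝ) ≤ N := by exact_mod_cast Nat.pos_of_ne_zero (by rintro rfl; simp at hN0)
  refine ⟨N, fun z hz => ⟨Complex.exp ((z.arg / N : ℝ) * Complex.I),
    Complex.norm_exp_ofReal_mul_I _, ?_, ?_⟩⟩
  · have hNc : (N : ℂ) ≠ 0 := by exact_mod_cast hN0.ne'
    rw [← Complex.exp_nat_mul]
    have : (N : ℂ) * (((z.arg / N : ℝ) : ℂ) * Complex.I) = z.arg * Complex.I := by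
      push_cast; field_simp
    rw [this]
    simpa [hz] using Complex.norm_mul_exp_arg_mul_I z
  · rw [Complex.exp_ofReal_mul_I_re]
    refine le_trans ?_ (Real.one_sub_sq_div_two_le_cos)
    have ha : z.arg ^ 2 ≤ Real.pi ^ 2 := sq_le_sq' (by linarith [Complex.neg_pi_lt_arg z])
      (Complex.arg_le_pi z)
    rw [div_lt_iff₀ (by linarith)] at hN
    have h1 : (z.arg / N) ^ 2 ≤ 1 - c := by
      rw [div_pow, div_le_iff₀ (by positivity)]
      nlinarith
    have := sq_nonneg (z.arg / N)
    linarith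

/-- Products of boundedly many conjugates of a noncentral element exhaust `SU(2)`. -/
lemma boundedlyGenerates_conjugates {u : ℂ} (hu : ‖u‖ = 1) (hne : u ^ 2 ≠ 1) :
    BoundedlyGenerates (conjugates (conjDiagonal u)) SU2 := by
  have hn2 : ‖u ^ 2‖ = 1 := by rw [norm_pow, hu, one_pow]
  have hlt : (u ^ 2).re < 1 := by
    refine lt_of_le_of_ne ((Complex.re_le_norm _).trans hn2.le) fun h => hne ?_
    rcases eq_or_eq_conj_of_re_eq hn2 norm_one (by simpa using h) with h | h
    · exact h
    · simpa using h
  obtain ⟨N, hN⟩ := exists_root_near_one hlt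
  -- The intermediate set is a neighbourhood of 1: each element costs two conjugates, and every
  -- element of `SU(2)` is an `N`-th power from it.
  refine BoundedlyGenerates.trans (S := {W | ∃ V ∈ SU2, ∃ y : ℂ, ‖y‖ = 1 ∧ (u ^ 2).re ≤ y.re ∧
    W = V * conjDiagonal y * Vᴴ}) ⟨2, ?_⟩ ⟨N, ?_⟩
  · rintro _ ⟨V, hV, y, hy, hre, rfl⟩
    obtain ⟨g, hg, h, hh, e⟩ := exists_conjugates_mul_eq hu hlt hy hre
    refine ⟨[V * g * Vᴴ, V * h * Vᴴ], ?_, ?_, by simp⟩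
    · intro v hv
      simp only [List.mem_cons, List.not_mem_nil, or_false] at hv
      rcases hv with rfl | rfl
      exacts [conj_mem_conjugates hg hV, conj_mem_conjugates hh hV]
    · have cancel : ∀ Z : Matrix (Fin 2) (Fin 2) ℂ, Vᴴ * (V * Z) = Z := fun Z => by
        rw [← Matrix.mul_assoc, SU2.conjTranspose_mul_self hV, Matrix.one_mul]
      rw [e]
      simp only [List.prod_cons, List.prod_nil, Matrix.mul_one, Matrix.mul_assoc, cancel]
  · intro W hW
    obtain ⟨V, hV, z, hz, rfl⟩ := exists_conjDiagonal hW
    obtain ⟨y, hy, rfl, hre⟩ := hN z hz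
    refine ⟨List.replicate N (V * conjDiagonal y * Vᴴ), ?_, ?_, by simp⟩
    · intro v hv
      rw [List.eq_of_mem_replicate hv]
      exact ⟨V, hV, y, hy, hre, rfl⟩
    · rw [List.prod_replicate]
      clear hz hW hN
      induction N with
      | zero =>
        have h1 : conjDiagonal 1 = 1 := by
          ext i j; fin_cases i <;> fin_cases j <;> simp [conjDiagonal]
        simp [h1, SU2.mul_conjTranspose_self hV]
      | succ N ih =>
        have cancel : ∀ Z : Matrix (Fin 2) (Fin 2) ℂ, Vᴴ * (V * Z) = Z := fun Z => by
          rw [← Matrix.mul_assoc, SU2.conjTranspose_mul_self hV, Matrix.one_mul]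
        rw [pow_succ, ih, pow_succ y, ← conjDiagonal_mul]
        simp only [Matrix.mul_assoc, cancel]

end SpecialUnitaryTwo

/-! ### Controlled gates and generation of all n-qubit unitaries -/

section Multiplexor

variable {n : ℕ}

/-- The bit strings of the qubits other than `t`. -/
abbrev Rest (t : Fin n) : Type := {j : Fin n // j ≠ t} → Fin 2

/-- The operator that acts on qubit `t` by the matrix `F r` when the other qubits are in the basis
state `r`. -/
def multiplexor (t : Fin n) : (Rest t → Matrix (Fin 2) (Fin 2) ℂ) →* Gate n where
  toFun F :=
    (blockDiagonal F).submatrix (Equiv.funSplitAt t (Fin 2)) (Equiv.funSplitAt t (Fin 2))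
  map_one' := by rw [blockDiagonal_one, submatrix_one_equiv]
  map_mul' F F' := by
    rw [submatrix_mul_equiv, ← blockDiagonal_mul]
    rfl

lemma multiplexor_eq (t : Fin n) (F : Rest t → Matrix (Fin 2) (Fin 2) ℂ) :
    multiplexor t F =
      (blockDiagonal F).submatrix (Equiv.funSplitAt t (Fin 2)) (Equiv.funSplitAt t (Fin 2)) :=
  rfl

lemma multiplexor_apply (t : Fin n) (F : Rest t → Matrix (Fin 2) (Fin 2) ℂ)
    (x y : Fin n → Fin 2) :
    multiplexor t F x y = if (∀ i, i ≠ t → x i = y i) then F (fun i => x i) (x t) (y t) else 0 := by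
  rw [multiplexor_eq, submatrix_apply, blockDiagonal_apply]
  refine if_congr ?_ rfl rfl
  constructor
  · intro h i hi
    exact congrFun h ⟨i, hi⟩
  · intro h
    ext i
    exact congrArg _ (h i i.2)

lemma multiplexor_diagonal (t : Fin n) (d : Rest t → Fin 2 → ℂ) :
    multiplexor t (fun r => diagonal (d r)) = diagonal fun x => d (fun i => x i) (x t) := by
  ext x y
  rw [multiplexor_apply]
  by_cases hxy : x = y
  · subst hxy; simp
  · rw [diagonal_apply_ne _ hxy]
    by_cases h : ∀ i, i ≠ t → x i = y i
    · have : x t ≠ y t := fun h' => hxy (by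
        ext1 i
        by_cases hi : i = t
        · rw [hi, h']
        · exact h i hi)
      simp [this]
    · simp [h]

lemma multiplexor_mem_unitaries (t : Fin n) {F : Rest t → Matrix (Fin 2) (Fin 2) ℂ}
    (hF : ∀ r, F r ∈ unitaryGroup (Fin 2) ℂ) : multiplexor t F ∈ unitaries n := by
  have h : star (multiplexor t F) = multiplexor t (fun r => star (F r)) := by
    rw [multiplexor_eq, multiplexor_eq, star_eq_conjTranspose, conjTranspose_submatrix,
      blockDiagonal_conjTranspose]
    rfl
  refine mem_unitaryGroup_iff'.2 ?_
  rw [h, ← map_mul, ← map_one (multiplexor t)]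
  congr 1
  ext1 r
  exact mem_unitaryGroup_iff'.1 (hF r)

open Classical in
/-- The family that applies `W` when the other qubits satisfy `P`. -/
noncomputable def when {t : Fin n} (P : Set (Rest t)) :
    Matrix (Fin 2) (Fin 2) ℂ →* (Rest t → Matrix (Fin 2) (Fin 2) ℂ) where
  toFun W r := if r ∈ P then W else 1
  map_one' := by ext1 r; simp
  map_mul' V W := by ext1 r; by_cases h : r ∈ P <;> simp [h]

open Classical in
lemma when_apply {t : Fin n} (P : Set (Rest t)) (W : Matrix (Fin 2) (Fin 2) ℂ) (r : Rest t) :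
    when P W r = if r ∈ P then W else 1 := rfl

/-- The special unitaries on qubit `t` controlled by the condition `P` on the other qubits. -/
def controlledSU2 (t : Fin n) (P : Set (Rest t)) : Set (Gate n) :=
  (multiplexor t).comp (when P) '' SU2

/-- The commutator of `g` controlled by `P` and `h` controlled by `Q` collapses to 1 unless both
conditions hold, and every special unitary is such a commutator. -/
lemma BoundedlyGenerates.controlledSU2_inter {T : Set (Gate n)} {t : Fin n} {P Q : Set (Rest t)}
    (hP : BoundedlyGenerates T (controlledSU2 t P))
    (hQ : BoundedlyGenerates T (controlledSU2 t Q)) :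
    BoundedlyGenerates T (controlledSU2 t (P ∩ Q)) := by
  refine (hP.union hQ).words 4 ?_
  rintro _ ⟨W, hW, rfl⟩
  obtain ⟨g, hg, h, hh, rfl⟩ := exists_commutator hW
  refine ⟨[multiplexor t (when P g), multiplexor t (when Q h), multiplexor t (when P gᴴ),
    multiplexor t (when Q hᴴ)], ?_, ?_, by simp⟩
  · intro v hv
    simp only [List.mem_cons, List.not_mem_nil, or_false] at hv
    rcases hv with rfl | rfl | rfl | rfl
    · exact Or.inl ⟨g, hg, rfl⟩
    · exact Or.inr ⟨h, hh, rfl⟩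
    · exact Or.inl ⟨_, SU2.conjTranspose hg, rfl⟩
    · exact Or.inr ⟨_, SU2.conjTranspose hh, rfl⟩
  · simp only [List.prod_cons, List.prod_nil, mul_one, ← map_mul]
    refine congrArg (multiplexor t) (funext fun r => ?_)
    by_cases h1 : r ∈ P <;> by_cases h2 : r ∈ Q <;>
      simp [when_apply, h1, h2, SU2.mul_conjTranspose_self hg, SU2.mul_conjTranspose_self hh,
        Matrix.mul_assoc]

lemma twoLevel_submatrix {ι κ : Type*} [Fintype ι] [DecidableEq ι] [Fintype κ] [DecidableEq κ]
    (e : κ ≃ ι) (i j : ι) (W : Matrix (Fin 2) (Fin 2) ℂ) :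
    (twoLevel i j W).submatrix e e = twoLevel (e.symm i) (e.symm j) W := by
  have h : pairEmbedding (e.symm i) (e.symm j) = (pairEmbedding i j).submatrix e id := by
    ext x b
    fin_cases b <;> simp [pairEmbedding, Equiv.eq_symm_apply]
  rw [twoLevel, twoLevel, h, conjTranspose_submatrix, submatrix_add, Pi.add_apply, Pi.add_apply,
    submatrix_one_equiv]
  rfl

lemma blockDiagonal_when_singleton {t : Fin n} (r : Rest t) (W : Matrix (Fin 2) (Fin 2) ℂ) :
    blockDiagonal (when {r} W) = twoLevel (0, r) (1, r) W := by
  ext ⟨b, s⟩ ⟨b', s'⟩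
  have h : twoLevel (0, r) (1, r) W (b, s) (b', s') =
    (twoLevel (0, r) (1, r) W *ᵥ Pi.single (b', s') 1) (b, s) := by simp
  rw [h, twoLevel_mulVec (by simp), blockDiagonal_apply]
  by_cases hs : s = r
  · subst hs
    by_cases hs' : s' = s
    · subst hs'
      fin_cases b <;> fin_cases b' <;> simp [when_apply]
    · fin_cases b <;> fin_cases b' <;> simp [Ne.symm hs']
  · simp [hs, when_apply, Pi.single_apply, Matrix.one_apply]
    grind

lemma controlledSU2_singleton (t : Fin n) (x : Fin n → Fin 2) :
    controlledSU2 t {(fun i => x i : Rest t)} =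
      specialTwoLevel (Function.update x t 0) (Function.update x t 1) := by
  have key : ∀ b, (Equiv.funSplitAt t (Fin 2)).symm (b, fun i => x i) = Function.update x t b := by
    intro b
    rw [Equiv.symm_apply_eq]
    ext i
    · simp
    · simp [i.2]
  rw [controlledSU2, specialTwoLevel]
  refine Set.image_congr fun W _ => ?_
  rw [MonoidHom.comp_apply, multiplexor_eq, blockDiagonal_when_singleton, twoLevel_submatrix, key,
    key]

/-- The bits of `x` are changed into those of `y` one at a time, and quarter turns join consecutive
two-level groups along this path. -/
lemma boundedlyGenerates_specialTwoLevel {T : Set (Gate n)}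
    (h : ∀ (t : Fin n) (x : Fin n → Fin 2), BoundedlyGenerates T
      (specialTwoLevel (Function.update x t 0) (Function.update x t 1)))
    (x y : Fin n → Fin 2) (hxy : x ≠ y) : BoundedlyGenerates T (specialTwoLevel x y) := by
  have step : ∀ (x : Fin n → Fin 2) (t : Fin n) (b : Fin 2), x ≠ Function.update x t b →
      BoundedlyGenerates T (specialTwoLevel x (Function.update x t b)) := by
    intro x t b hne
    have hb : b ≠ x t := by rintro rfl; simp at hne
    have hx : x = Function.update x t (x t) := by simp
    rcases (show (x t = 0 ∧ b = 1) ∨ (x t = 1 ∧ b = 0) by omega) with ⟨h0, h1⟩ | ⟨h0, h1⟩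
    · have := h t x
      rwa [← h0, ← hx, ← h1] at this
    · have := (h t x).mono_right (specialTwoLevel_symm _ _)
      rwa [← h0, ← hx, ← h1] at this
  -- Here `s` is the set of positions already treated; the first alternative covers the case where
  -- `x` and `y` agree on them.
  have key : ∀ s : Finset (Fin n), x = s.piecewise y x ∨
      BoundedlyGenerates T (specialTwoLevel x (s.piecewise y x)) := by
    intro s
    induction s using Finset.induction_on with
    | empty => left; simp
    | insert t s _ ih =>
      rw [Finset.piecewise_insert]
      set z := s.piecewise y x
      by_cases h1 : x = Function.update z t (y t)
      · exact Or.inl h1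
      · right
        by_cases h2 : z = Function.update z t (y t)
        · rw [← h2] at h1 ⊢
          exact ih.resolve_left h1
        · rcases ih with ih | ih
          · have := step z t (y t) h2
            rwa [ih.symm] at this ⊢
          · by_cases h3 : x = z
            · rw [h3]; exact step z t (y t) h2
            · exact boundedlyGenerates_specialTwoLevel_trans h2 h3 h1 ih (step z t (y t) h2)
  simpa [hxy] using key Finset.univ

/-- One-qubit unitaries and singly controlled special unitaries generate all `n`-qubit unitaries
with words of bounded length. -/
lemma boundedlyGenerates_unitaries (hn : 0 < n) {T : Set (Gate n)}
    (h1 : ∀ t : Fin n, BoundedlyGenerates T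
      {V | ∃ W ∈ unitaryGroup (Fin 2) ℂ, V = multiplexor t fun _ => W})
    (h2 : ∀ (t : Fin n) (a : {j : Fin n // j ≠ t}) (b : Fin 2),
      BoundedlyGenerates T (controlledSU2 t {r | r a = b})) :
    BoundedlyGenerates T (unitaries n) := by
  refine boundedlyGenerates_unitaryGroup (boundedlyGenerates_specialTwoLevel fun t x => ?_) ?_
  · rw [← controlledSU2_singleton]
    have key : ∀ s : Finset {j : Fin n // j ≠ t},
        BoundedlyGenerates T (controlledSU2 t {r | ∀ a ∈ s, r a = x a}) := by
      intro s
      induction s using Finset.induction_on with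
      | empty =>
        refine (h1 t).mono_right ?_
        rintro _ ⟨W, hW, rfl⟩
        exact ⟨W, (mem_specialUnitaryGroup_iff.1 hW).1, 
          congrArg (multiplexor t) (funext fun r => by simp [when_apply])⟩
      | insert a s _ ih =>
        convert (h2 t a (x a)).controlledSU2_inter ih using 2
        ext r
        simp
    convert key Finset.univ using 2
    ext r
    simp [funext_iff]
  -- A global phase is a scalar gate on any one qubit; this is where a qubit must exist.
  · refine (h1 ⟨0, hn⟩).mono_right ?_
    rintro _ ⟨z, hz, rfl⟩
    refine ⟨z • 1, ?_, ?_⟩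
    · rw [mem_unitaryGroup_iff, star_smul, star_one, smul_mul_smul_comm, Matrix.mul_one]
      have := mul_conj_of_norm_eq_one hz
      rw [Complex.star_def, this, one_smul]
    · rw [smul_one_eq_diagonal, smul_one_eq_diagonal]
      exact (multiplexor_diagonal ⟨0, hn⟩ fun _ _ => z).symm

end Multiplexor

/-! ### Universality of one-qubit gates with a controlled phase -/

section LogicalGates

variable {n : ℕ}

lemma onQubits_multiplexor {k : ℕ} (f : Fin k ↪ Fin n) (s : Fin k)
    (F : Rest s → Matrix (Fin 2) (Fin 2) ℂ) :
    onQubits f (multiplexor s F) =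
      multiplexor (f s) fun r => F fun i => r ⟨f i, fun h => i.2 (f.injective h)⟩ := by
  ext x y
  simp only [onQubits, multiplexor_apply, Function.comp_apply]
  rw [← ite_and]
  refine if_congr ?_ rfl rfl
  constructor
  · rintro ⟨h1, h2⟩ i hi
    by_cases h : ∃ j, f j = i
    · obtain ⟨j, rfl⟩ := h
      exact h2 j fun h => hi (h ▸ rfl)
    · exact h1 i fun j hj => h ⟨j, hj⟩
  · intro h
    exact ⟨fun i hi => h i (hi s).symm, fun i hi => h _ fun h' => hi (f.injective h')⟩

lemma multiplexor_const_mem_oneAndTwoQubit (t : Fin n) {W : Matrix (Fin 2) (Fin 2) ℂ}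
    (hW : W ∈ unitaryGroup (Fin 2) ℂ) : (multiplexor t fun _ => W) ∈ oneAndTwoQubit n :=
  ⟨1, le_rfl, by norm_num, ⟨fun _ => t, Function.injective_of_subsingleton _⟩,
    multiplexor 0 fun _ => W, multiplexor_mem_unitaries 0 fun _ => hW,
    by rw [onQubits_multiplexor]; rfl⟩

lemma controlledSU2_subset_oneAndTwoQubit (t : Fin n) (a : {j : Fin n // j ≠ t}) (b : Fin 2) :
    controlledSU2 t {r | r a = b} ⊆ oneAndTwoQubit n := by
  rintro _ ⟨W, hW, rfl⟩
  refine ⟨2, by norm_num, le_rfl, ⟨![t, a], ?_⟩, multiplexor 0 (when {r | r ⟨1, by simp⟩ = b} W),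
    multiplexor_mem_unitaries 0 fun r => ?_, ?_⟩
  · have := a.2
    intro i j
    fin_cases i <;> fin_cases j <;> simp [this, this.symm]
  · rw [when_apply]
    split_ifs
    exacts [(mem_specialUnitaryGroup_iff.1 hW).1, one_mem _]
  · rw [onQubits_multiplexor]
    rfl

/-- The one- and two-qubit unitaries generate all unitaries on any positive number of qubits. -/
lemma boundedlyGenerates_oneAndTwoQubit (hn : 0 < n) :
    BoundedlyGenerates (oneAndTwoQubit n) (unitaries n) := by
  refine boundedlyGenerates_unitaries hn (fun t => ?_) fun t a b => ?_
  · refine BoundedlyGenerates.of_subset ?_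
    rintro _ ⟨W, hW, rfl⟩
    exact multiplexor_const_mem_oneAndTwoQubit t hW
  · exact BoundedlyGenerates.of_subset (controlledSU2_subset_oneAndTwoQubit t a b)

/-- The two-qubit controlled phase `diag(1, 1, 1, w)`. -/
def controlledPhase (w : ℂ) : Gate 2 := diagonal fun x => if x 0 = 1 ∧ x 1 = 1 then w else 1

/-- The controlled phase is symmetric, so either qubit may be taken as the target. -/
lemma controlledPhase_eq_multiplexor (t : Fin 2) (a : {j : Fin 2 // j ≠ t}) (w : ℂ) :
    controlledPhase w = multiplexor t (when {r | r a = 1} (diagonal ![1, w])) := by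
  have h : when {r : Rest t | r a = 1} (diagonal ![1, w]) =
      fun r => diagonal fun b => if r a = 1 ∧ b = 1 then w else 1 := by
    ext1 r
    rw [when_apply]
    by_cases hr : r a = 1
    · ext i j; fin_cases i <;> fin_cases j <;> simp [hr]
    · simp [hr]
  rw [h, multiplexor_diagonal t fun r b => if r a = 1 ∧ b = 1 then w else 1, controlledPhase]
  congr 1
  ext x
  obtain ⟨a, ha⟩ := a
  refine if_congr ?_ rfl rfl
  fin_cases t <;> fin_cases a <;> simp at ha ⊢
  exact and_comm

/-- Phase kickback: this supplies the scalar that brings a controlled phase into `SU(2)`. -/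
lemma multiplexor_const_phase (t : Fin n) (a : {j : Fin n // j ≠ t}) (c : ℂ) :
    (multiplexor (a : Fin n) fun _ => diagonal ![1, c]) =
      multiplexor t (when {r | r a = 1} (c • 1)) := by
  have h : when {r : Rest t | r a = 1} (c • 1) =
      fun r => diagonal fun _ => if r a = 1 then c else 1 := by
    ext1 r
    rw [when_apply]
    by_cases hr : r a = 1
    · simp [hr, smul_one_eq_diagonal]
    · simp [hr]
  rw [h, multiplexor_diagonal t fun r _ => if r a = 1 then c else 1,
    multiplexor_diagonal (a : Fin n) fun _ => ![1, c]]
  congr 1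
  ext x
  have : ∀ b : Fin 2, (![1, c] : Fin 2 → ℂ) b = if b = 1 then c else 1 := by
    intro b; fin_cases b <;> simp
  exact this _

/-- The one-qubit unitaries on two qubits, together with the controlled phase `w`. -/
def localAndControlledPhase (w : ℂ) : Set (Gate 2) :=
  {V | ∃ t : Fin 2, ∃ W ∈ unitaryGroup (Fin 2) ℂ, V = multiplexor t fun _ => W} ∪
    {controlledPhase w}

/-- One-qubit unitaries and any one nontrivial controlled phase generate the two-qubit unitaries
with words of bounded length. -/
lemma boundedlyGenerates_localAndControlledPhase {w : ℂ} (hw : ‖w‖ = 1) (hw1 : w ≠ 1) :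
    BoundedlyGenerates (localAndControlledPhase w) (unitaries 2) := by
  have hlocal : ∀ (t : Fin 2) {W : Matrix (Fin 2) (Fin 2) ℂ}, W ∈ unitaryGroup (Fin 2) ℂ →
      (multiplexor t fun _ => W) ∈ localAndControlledPhase w :=
    fun t W hW => Or.inl ⟨t, W, hW, rfl⟩
  -- With `u² = conj w`, the matrix `u · diag(1, w)` equals `diag(u, conj u)`; it is noncentral
  -- exactly because `w ≠ 1`.
  obtain ⟨u, hu⟩ := IsAlgClosed.exists_pow_nat_eq (conj w) (n := 2) (by norm_num)
  have hu1 : ‖u‖ = 1 := by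
    have : ‖u ^ 2‖ = 1 := by rw [hu, Complex.norm_conj, hw]
    rw [norm_pow] at this
    exact (pow_eq_one_iff_of_nonneg (norm_nonneg _) two_ne_zero).1 this
  have hne : u ^ 2 ≠ 1 := by
    rw [hu]
    intro h
    exact hw1 (by simpa using congrArg conj h)
  have huu := mul_conj_of_norm_eq_one hu1
  have hwu : w = conj u ^ 2 := by rw [← map_pow, hu, Complex.conj_conj]
  have hcontrol : ∀ (t : Fin 2) (a : {j : Fin 2 // j ≠ t}),
      BoundedlyGenerates (localAndControlledPhase w) (controlledSU2 t {r | r a = 1}) := by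
    intro t a
    refine BoundedlyGenerates.trans (S := (multiplexor t).comp (when {r | r a = 1}) ''
      conjugates (conjDiagonal u)) ⟨4, ?_⟩ ((boundedlyGenerates_conjugates hu1 hne).image _)
    rintro _ ⟨_, ⟨V, hV, rfl⟩, rfl⟩
    have hVu := (mem_specialUnitaryGroup_iff.1 hV).1
    have hVu' := (mem_specialUnitaryGroup_iff.1 (SU2.conjTranspose hV)).1
    refine ⟨[multiplexor t fun _ => V, multiplexor (a : Fin 2) fun _ => diagonal ![1, u],
      controlledPhase w, multiplexor t fun _ => Vᴴ], ?_, ?_, by simp⟩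
    · intro v hv
      simp only [List.mem_cons, List.not_mem_nil, or_false] at hv
      rcases hv with rfl | rfl | rfl | rfl
      · exact hlocal t hVu
      · refine hlocal _ (mem_unitaryGroup_iff.2 ?_)
        ext i j
        fin_cases i <;> fin_cases j <;>
          simp [star_eq_conjTranspose, diagonal_conjTranspose, huu]
      · exact Or.inr rfl
      · exact hlocal t hVu'
    · rw [multiplexor_const_phase t a, controlledPhase_eq_multiplexor t a]
      simp only [List.prod_cons, List.prod_nil, mul_one, ← map_mul, MonoidHom.comp_apply]
      refine congrArg (multiplexor t) (funext fun r => ?_)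
      by_cases hr : r a = 1
      · have : conjDiagonal u = u • diagonal ![1, w] := by
          ext i j
          fin_cases i <;> fin_cases j <;> simp [conjDiagonal]
          rw [hwu]
          linear_combination (-conj u) * huu
        simp [when_apply, hr, this, Matrix.mul_assoc]
      · simp [when_apply, hr, SU2.mul_conjTranspose_self hV]
  refine boundedlyGenerates_unitaries (by norm_num) (fun t => ?_) fun t a b => ?_
  · refine BoundedlyGenerates.of_subset ?_
    rintro _ ⟨W, hW, rfl⟩
    exact hlocal t hW
  · rcases (show b = 1 ∨ b = 0 by omega) with rfl | rfl
    · exact hcontrol t a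
    -- Control on 0: apply `W` always and undo it when the control bit is 1.
    · refine (BoundedlyGenerates.of_subset Set.Subset.rfl).mul (hcontrol t a) ?_
      rintro _ ⟨W, hW, rfl⟩
      refine ⟨_, hlocal t (mem_specialUnitaryGroup_iff.1 hW).1, _,
        ⟨Wᴴ, SU2.conjTranspose hW, rfl⟩, ?_⟩
      simp only [← map_mul, MonoidHom.comp_apply]
      refine congrArg (multiplexor t) (funext fun r => ?_)
      rcases (show r a = 1 ∨ r a = 0 by omega) with hr | hr <;>
        simp [when_apply, hr, SU2.mul_conjTranspose_self hW]

end LogicalGates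

/-! ### Gates placed in a register, and qubit permutations -/

section Register

variable {n : ℕ}

lemma onQubits_mul {k : ℕ} (f : Fin k ↪ Fin n) (U V : Gate k) :
    onQubits f (U * V) = onQubits f U * onQubits f V := by
  ext x y
  have hcomp : ∀ c : Fin k → Fin 2, Function.extend f c x ∘ f = c := fun c =>
    funext fun j => f.injective.extend_apply c x j
  have hout : ∀ (c : Fin k → Fin 2) i, (∀ j, f j ≠ i) → Function.extend f c x i = x i :=
    fun c i hi => Function.extend_apply' c x i fun ⟨j, hj⟩ => hi j hj
  rw [Matrix.mul_apply, onQubits]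
  by_cases hxy : ∀ i, (∀ j, f j ≠ i) → x i = y i
  · rw [if_pos hxy, Matrix.mul_apply]
    -- Only intermediate strings that agree with `x` off the range of `f` contribute, and these
    -- correspond to the strings `c` on `k` qubits.
    refine Finset.sum_of_injOn (fun c => Function.extend f c x) ?_ (by simp) ?_ ?_
    · intro c _ c' _ h
      rw [← hcomp c, ← hcomp c']
      exact congrArg (· ∘ f) h
    · intro z _ hz
      have : ¬ ∀ i, (∀ j, f j ≠ i) → x i = z i := by
        intro h
        refine hz ⟨z ∘ f, by simp, funext fun i => ?_⟩
        by_cases hi : ∃ j, f j = i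
        · obtain ⟨j, rfl⟩ := hi
          exact f.injective.extend_apply _ _ _
        · push Not at hi
          exact (hout _ i hi).trans (h i hi)
      simp [onQubits, this]
    · intro c _
      have h1 : ∀ i, (∀ j, f j ≠ i) → x i = Function.extend f c x i :=
        fun i hi => (hout c i hi).symm
      have h2 : ∀ i, (∀ j, f j ≠ i) → Function.extend f c x i = y i :=
        fun i hi => (hout c i hi).trans (hxy i hi)
      simp only [onQubits]
      rw [if_pos h1, if_pos h2, hcomp]
  · rw [if_neg hxy, eq_comm]
    refine Finset.sum_eq_zero fun z _ => ?_
    by_cases h1 : ∀ i, (∀ j, f j ≠ i) → x i = z i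
    · have h2 : ¬ ∀ i, (∀ j, f j ≠ i) → z i = y i := fun h2 =>
        hxy fun i hi => (h1 i hi).trans (h2 i hi)
      simp [onQubits, h2]
    · simp [onQubits, h1]

lemma onQubits_diagonal {k : ℕ} (f : Fin k ↪ Fin n) (d : (Fin k → Fin 2) → ℂ) :
    onQubits f (diagonal d) = diagonal fun x => d (x ∘ f) := by
  ext x y
  rw [onQubits]
  by_cases hxy : x = y
  · subst hxy; simp
  · rw [diagonal_apply_ne _ hxy]
    by_cases h : ∀ i, (∀ j, f j ≠ i) → x i = y i
    · rw [if_pos h, diagonal_apply_ne]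
      intro h'
      apply hxy
      ext1 i
      by_cases hi : ∃ j, f j = i
      · obtain ⟨j, rfl⟩ := hi
        exact congrFun h' j
      · exact h i fun j hj => hi ⟨j, hj⟩
    · rw [if_neg h]

lemma onQubits_one {k : ℕ} (f : Fin k ↪ Fin n) : onQubits f 1 = 1 := by
  rw [← diagonal_one, onQubits_diagonal, ← diagonal_one]

lemma onQubits_list_prod {k : ℕ} (f : Fin k ↪ Fin n) (l : List (Gate k)) :
    onQubits f l.prod = (l.map (onQubits f)).prod := by
  induction l with
  | nil => exact onQubits_one f
  | cons a l ih => rw [List.prod_cons, onQubits_mul, ih, List.map_cons, List.prod_cons]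

/-- The monomial operator that permutes the qubits by `σ` and multiplies the basis vector `y` by
`s y`. -/
def signedPermGate (σ : Equiv.Perm (Fin n)) (s : (Fin n → Fin 2) → ℂ) : Gate n :=
  fun x y => if x = y ∘ σ then s y else 0

lemma signedPermGate_mul (σ τ : Equiv.Perm (Fin n)) (s s' : (Fin n → Fin 2) → ℂ) :
    signedPermGate σ s * signedPermGate τ s' =
      signedPermGate (τ * σ) fun y => s (y ∘ τ) * s' y := by
  ext x y
  rw [Matrix.mul_apply, Finset.sum_eq_single (y ∘ τ)]
  · by_cases h : x = (y ∘ τ) ∘ σ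
    · have h' : x = y ∘ ⇑(τ * σ) := h
      rw [signedPermGate, if_pos h, signedPermGate, if_pos rfl, signedPermGate, if_pos h']
    · have h' : ¬ x = y ∘ ⇑(τ * σ) := h
      rw [signedPermGate, if_neg h, zero_mul, signedPermGate, if_neg h']
  · intro z _ hz
    simp [signedPermGate, hz]
  · simp

/-- The operator that exchanges the qubits `a` and `b`. -/
def swapGate (a b : Fin n) : Gate n := signedPermGate (Equiv.swap a b) fun _ => 1

lemma swapGate_conj (a b : Fin n) {k : ℕ} (f : Fin k ↪ Fin n) (U : Gate k) :
    swapGate a b * onQubits (f.trans (Equiv.swap a b).toEmbedding) U * swapGate a b =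
      onQubits f U := by
  have hinv : ∀ x : Fin n → Fin 2, (x ∘ Equiv.swap a b) ∘ Equiv.swap a b = x := fun x => by
    ext i; simp
  ext x y
  rw [Matrix.mul_apply, Finset.sum_eq_single (y ∘ Equiv.swap a b), Matrix.mul_apply,
    Finset.sum_eq_single (x ∘ Equiv.swap a b)]
  · simp only [swapGate, signedPermGate, hinv, if_true, one_mul, mul_one, onQubits]
    refine if_congr ?_ ?_ rfl
    · constructor
      · intro h i hi
        have := h (Equiv.swap a b i) fun j hj => hi j ((Equiv.swap a b).injective hj)
        simpa using this
      · intro h i hi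
        refine h _ fun j hj => hi j ?_
        simp [hj]
    · congr 1 <;> (ext i; simp)
  · intro z _ hz
    have : x ≠ z ∘ Equiv.swap a b := fun h => hz (by rw [h, hinv])
    simp [swapGate, signedPermGate, this]
  · simp
  · intro z _ hz
    simp [swapGate, signedPermGate, hz]
  · simp

end Register

/-! ### Algebra of parity-preserving gates -/

section TwoQubit

lemma sum_two_qubits {M : Type*} [AddCommMonoid M] (g : (Fin 2 → Fin 2) → M) :
    ∑ z, g z = g ![0, 0] + g ![0, 1] + (g ![1, 0] + g ![1, 1]) := by
  rw [← (finTwoArrowEquiv (Fin 2)).symm.sum_comp, Fintype.sum_prod_type]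
  simp [Fin.sum_univ_two, finTwoArrowEquiv]

lemma exists_eq_pair (x : Fin 2 → Fin 2) : ∃ a b, x = ![a, b] :=
  ⟨x 0, x 1, by ext i; fin_cases i <;> simp⟩

lemma G_mul (A B C D : Matrix (Fin 2) (Fin 2) ℂ) : G A B * G C D = G (A * C) (B * D) := by
  ext x y
  rw [Matrix.mul_apply, sum_two_qubits]
  by_cases hx : x 0 = x 1 <;> by_cases hy : y 0 = y 1 <;>
    simp [G, hx, hy, Matrix.mul_apply, Fin.sum_univ_two]

lemma G_conjTranspose (A B : Matrix (Fin 2) (Fin 2) ℂ) : (G A B)ᴴ = G Aᴴ Bᴴ := by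
  ext x y
  by_cases hx : x 0 = x 1 <;> by_cases hy : y 0 = y 1 <;> simp [G, hx, hy]

lemma G_diagonal_one (w : ℂ) : G (diagonal ![1, w]) 1 = controlledPhase w := by
  ext x y
  obtain ⟨a, b, rfl⟩ := exists_eq_pair x
  obtain ⟨c, d, rfl⟩ := exists_eq_pair y
  fin_cases a <;> fin_cases b <;> fin_cases c <;> fin_cases d <;>
    simp [G, controlledPhase, Matrix.one_apply]

lemma G_one : G 1 1 = 1 := by
  have h : (1 : Matrix (Fin 2) (Fin 2) ℂ) = diagonal ![1, 1] := by
    rw [← diagonal_one]; congr 1; ext i; fin_cases i <;> rfl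
  nth_rw 1 [h]
  rw [G_diagonal_one, controlledPhase, ← diagonal_one]
  simp

lemma G_mem_unitaries {C D : Matrix (Fin 2) (Fin 2) ℂ} (hC : C ∈ unitaryGroup (Fin 2) ℂ)
    (hD : D ∈ unitaryGroup (Fin 2) ℂ) : G C D ∈ unitaries 2 := by
  refine mem_unitaryGroup_iff'.2 ?_
  rw [star_eq_conjTranspose, G_conjTranspose, G_mul, ← star_eq_conjTranspose,
    ← star_eq_conjTranspose, mem_unitaryGroup_iff'.1 hC, mem_unitaryGroup_iff'.1 hD, G_one]

lemma G_injective {A B C D : Matrix (Fin 2) (Fin 2) ℂ} (h : G A B = G C D) : A = C ∧ B = D := by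
  constructor
  · ext i j
    simpa [G] using congrFun (congrFun h ![i, i]) ![j, j]
  · ext i j
    have hne : ∀ k : Fin 2, k ≠ k + 1 := by decide
    simpa [G, hne] using congrFun (congrFun h ![i, i + 1]) ![j, j + 1]

lemma unitary_of_G_mem_unitaries {A B : Matrix (Fin 2) (Fin 2) ℂ} (h : G A B ∈ unitaries 2) :
    A ∈ unitaryGroup (Fin 2) ℂ ∧ B ∈ unitaryGroup (Fin 2) ℂ := by
  have h1 := mem_unitaryGroup_iff.1 h
  rw [star_eq_conjTranspose, G_conjTranspose, G_mul, ← G_one] at h1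
  exact ⟨mem_unitaryGroup_iff.2 (G_injective h1).1, mem_unitaryGroup_iff.2 (G_injective h1).2⟩

lemma norm_det_of_mem_unitaryGroup {A : Matrix (Fin 2) (Fin 2) ℂ}
    (hA : A ∈ unitaryGroup (Fin 2) ℂ) : ‖A.det‖ = 1 :=
  CStarRing.norm_of_mem_unitary (Matrix.det_of_mem_unitary hA)

lemma diagonal_mem_unitaryGroup {c : ℂ} (hc : ‖c‖ = 1) :
    diagonal ![1, c] ∈ unitaryGroup (Fin 2) ℂ := by
  have := mul_conj_of_norm_eq_one hc
  refine mem_unitaryGroup_iff.2 ?_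
  ext i j
  fin_cases i <;> fin_cases j <;> simp [star_eq_conjTranspose, diagonal_conjTranspose, this]

/-- The odd block serves only to match the determinant of an arbitrary even block. -/
lemma G_det_mem_matchgates {W : Matrix (Fin 2) (Fin 2) ℂ} (hW : W ∈ unitaryGroup (Fin 2) ℂ) :
    G W (diagonal ![1, W.det]) ∈ matchgates :=
  ⟨G_mem_unitaries hW (diagonal_mem_unitaryGroup (norm_det_of_mem_unitaryGroup hW)), _, _,
    by simp [det_diagonal, Fin.prod_univ_two], rfl⟩

/-- A parity-preserving gate that is not a matchgate becomes a nontrivial controlled phase after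
composition with a matchgate. -/
lemma exists_matchgate_mul_eq_controlledPhase {A B : Matrix (Fin 2) (Fin 2) ℂ}
    (hG : G A B ∈ unitaries 2) (hdet : A.det ≠ B.det) :
    ∃ w : ℂ, ‖w‖ = 1 ∧ w ≠ 1 ∧ ∃ V ∈ matchgates, G A B * V = controlledPhase w := by
  obtain ⟨hA, hB⟩ := unitary_of_G_mem_unitaries hG
  have hA1 := norm_det_of_mem_unitaryGroup hA
  have hB1 := norm_det_of_mem_unitaryGroup hB
  have hAA := mul_conj_of_norm_eq_one hA1
  have hBB := mul_conj_of_norm_eq_one hB1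
  set w := A.det * conj B.det with hw
  have hw1 : ‖w‖ = 1 := by rw [hw, norm_mul, Complex.norm_conj, hA1, hB1, one_mul]
  -- The factor cancels both blocks up to `diag(1, w)`, and this `w` is the value that makes its
  -- determinants agree.
  refine ⟨w, hw1, fun h => hdet ?_, G (Aᴴ * diagonal ![1, w]) Bᴴ, ⟨?_, _, _, ?_, rfl⟩, ?_⟩
  · linear_combination B.det * h - A.det * hBB
  · exact G_mem_unitaries (mul_mem (Unitary.star_mem hA) (diagonal_mem_unitaryGroup hw1))
      (Unitary.star_mem hB)
  · rw [det_mul, det_conjTranspose, det_conjTranspose, det_diagonal, Fin.prod_univ_two]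
    simp only [RCLike.star_def, cons_val_zero, cons_val_one, one_mul, hw]
    linear_combination (conj B.det) * hAA
  · have h1 : A * Aᴴ = 1 := mem_unitaryGroup_iff.1 hA
    have h2 : B * Bᴴ = 1 := mem_unitaryGroup_iff.1 hB
    rw [G_mul, ← Matrix.mul_assoc, h1, h2, Matrix.one_mul, G_diagonal_one]

/-- The fermionic swap. -/
def fermionicSwap : Gate 2 := G (diagonal ![1, -1]) pauliX

/-- The sign on `|11⟩` gives both blocks determinant -1; the ordinary swap, with determinants 1 and
-1, is not a matchgate. -/
lemma fermionicSwap_mem_matchgates : fermionicSwap ∈ matchgates :=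
  ⟨G_mem_unitaries (diagonal_mem_unitaryGroup (by simp)) pauliX_mem_unitaryGroup, _, _,
    by simp [det_pauliX, det_diagonal, Fin.prod_univ_two], rfl⟩

lemma fermionicSwap_apply (x y : Fin 2 → Fin 2) :
    fermionicSwap x y =
      if x 0 = y 1 ∧ x 1 = y 0 then (if y 0 = 1 ∧ y 1 = 1 then -1 else 1) else 0 := by
  obtain ⟨a, b, rfl⟩ := exists_eq_pair x
  obtain ⟨c, d, rfl⟩ := exists_eq_pair y
  fin_cases a <;> fin_cases b <;> fin_cases c <;> fin_cases d <;>
    simp [G, fermionicSwap, pauliX]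

lemma onQubits_fermionicSwap {n : ℕ} (f : Fin 2 ↪ Fin n) :
    onQubits f fermionicSwap = signedPermGate (Equiv.swap (f 0) (f 1))
      fun y => if y (f 0) = 1 ∧ y (f 1) = 1 then -1 else 1 := by
  ext x y
  simp only [onQubits, fermionicSwap_apply, signedPermGate, Function.comp_apply]
  rw [← ite_and]
  refine if_congr ?_ rfl rfl
  constructor
  · rintro ⟨h1, h2, h3⟩
    ext1 i
    rw [Function.comp_apply]
    by_cases hi : i = f 0
    · rw [hi, Equiv.swap_apply_left, h2]
    · by_cases hi' : i = f 1
      · rw [hi', Equiv.swap_apply_right, h3]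
      · rw [Equiv.swap_apply_of_ne_of_ne hi hi']
        refine h1 i fun j => ?_
        fin_cases j
        exacts [Ne.symm hi, Ne.symm hi']
  · rintro rfl
    refine ⟨fun i hi => ?_, by simp, by simp⟩
    rw [Function.comp_apply, Equiv.swap_apply_of_ne_of_ne (hi 0).symm (hi 1).symm]

end TwoQubit

/-! ### Physical circuits that implement logical gates -/

section Encoding

variable {n : ℕ}

/-- The physical bit string that encodes a logical one. -/
def encode (y : Fin n → Fin 2) : Fin (n * 2) → Fin 2 := fun i => y i.divNat

lemma encoding_apply (x : Fin (n * 2) → Fin 2) (y : Fin n → Fin 2) :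
    encoding n x y = if x = encode y then 1 else 0 :=
  if_congr funext_iff.symm rfl rfl

lemma encode_injective : Function.Injective (encode (n := n)) := by
  intro y z h
  ext1 j
  have := congrFun h ⟨2 * j, by omega⟩
  have e : (⟨2 * j, by omega⟩ : Fin (n * 2)).divNat = j := by
    ext; simp [Fin.divNat]
  simpa [encode, e] using this

lemma implements_of {V : Gate (n * 2)} {U : Gate n}
    (h1 : ∀ x y, V (encode x) (encode y) = U x y)
    (h2 : ∀ x y, (∀ z, x ≠ encode z) → V x (encode y) = 0) : Implements V U := by
  ext x y
  have e : (V * encoding n) x y = V x (encode y) := by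
    simp [Matrix.mul_apply, encoding_apply]
  rw [e, Matrix.mul_apply]
  by_cases hx : ∃ z, x = encode z
  · obtain ⟨z, rfl⟩ := hx
    rw [h1, Finset.sum_eq_single z]
    · simp [encoding_apply]
    · intro z' _ hz'
      have : encode z ≠ encode z' := fun h => hz' (encode_injective h).symm
      simp [encoding_apply, this]
    · simp
  · push Not at hx
    rw [h2 x y hx, eq_comm]
    exact Finset.sum_eq_zero fun z _ => by simp [encoding_apply, hx z]

lemma Implements.mul {V V' : Gate (n * 2)} {U U' : Gate n} (h : Implements V U)
    (h' : Implements V' U') : Implements (V * V') (U * U') := by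
  unfold Implements at *
  rw [Matrix.mul_assoc, h', ← Matrix.mul_assoc, h, Matrix.mul_assoc]

lemma implements_diagonal {d' : (Fin (n * 2) → Fin 2) → ℂ} {d : (Fin n → Fin 2) → ℂ}
    (h : ∀ x, d' (encode x) = d x) : Implements (diagonal d') (diagonal d) := by
  refine implements_of (fun x y => ?_) fun x y hx => diagonal_apply_ne _ (hx y)
  by_cases hxy : x = y
  · subst hxy; simp [h]
  · rw [diagonal_apply_ne _ hxy, diagonal_apply_ne _ (encode_injective.ne hxy)]

lemma implements_signedPermGate {σ' : Equiv.Perm (Fin (n * 2))} {σ : Equiv.Perm (Fin n)}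
    {s : (Fin (n * 2) → Fin 2) → ℂ} (hs : ∀ y, s (encode y) = 1)
    (hσ : ∀ i, (σ' i).divNat = σ i.divNat) :
    Implements (signedPermGate σ' s) (signedPermGate σ fun _ => 1) := by
  have key : ∀ y : Fin n → Fin 2, encode y ∘ σ' = encode (y ∘ σ) := fun y => by
    ext1 i; simp [encode, hσ]
  refine implements_of (fun x y => ?_) fun x y hx => ?_
  · simp only [signedPermGate, key, hs]
    exact if_congr encode_injective.eq_iff rfl rfl
  · rw [signedPermGate, if_neg]
    rw [key]
    exact hx _

lemma neighbours_val (i : ℕ) (h : i + 1 < n) (k : Fin 2) : (neighbours i h k : ℕ) = i + k := rfl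

/-- The states `|00⟩`, `|11⟩` of the pair are both the logical basis and the basis of the even
block, so `D` is arbitrary. -/
lemma implements_G (j : Fin n) (W D : Matrix (Fin 2) (Fin 2) ℂ) :
    Implements (onQubits (neighbours (2 * j) (by omega)) (G W D)) (multiplexor j fun _ => W) := by
  have hnb : ∀ k : Fin 2, (neighbours (n := n * 2) (2 * j) (by omega) k).divNat = j := by
    intro k; ext; simp only [Fin.coe_divNat, neighbours_val]; omega
  have hout : ∀ i : Fin (n * 2), (∀ k, neighbours (2 * (j : ℕ)) (by omega) k ≠ i) ↔
      i.divNat ≠ j := by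
    intro i
    constructor
    · intro h hi
      have hi' : (i : ℕ) / 2 = j := congrArg Fin.val hi
      refine h ⟨i % 2, Nat.mod_lt _ (by norm_num)⟩ (Fin.ext ?_)
      simp only [neighbours_val]
      omega
    · rintro h k rfl
      exact h (hnb k)
  refine implements_of (fun x y => ?_) fun x y hx => ?_
  · rw [onQubits, multiplexor_apply]
    refine if_congr ?_ ?_ rfl
    · constructor
      · intro h i hi
        have e : (⟨2 * i, by omega⟩ : Fin (n * 2)).divNat = i := by ext; simp [Fin.divNat]
        have := h ⟨2 * i, by omega⟩ ((hout _).2 (by rwa [e]))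
        simpa [encode, e] using this
      · intro h i hi
        exact h _ ((hout i).1 hi)
    · simp [G, encode, hnb]
  · rw [onQubits]
    split_ifs with h
    · by_cases hx' : x (neighbours (2 * j) (by omega) 0) = x (neighbours (2 * j) (by omega) 1)
      -- No leakage: a string with equal bits on the pair that agrees with an encoded one elsewhere
      -- is itself encoded.
      · refine absurd (funext fun i => ?_)
          (hx (Function.update y j (x (neighbours (2 * j) (by omega) 0))))
        by_cases hi : ∃ k, neighbours (2 * (j : ℕ)) (by omega) k = i
        · obtain ⟨k, rfl⟩ := hi
          fin_cases k
          · simp [encode, hnb]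
          · simp [encode, hnb, hx']
        · push Not at hi
          have := (hout i).1 hi
          rw [h i hi]
          simp [encode, this]
      · simp [G, encode, hnb, hx']
    · rfl

/-- The physical qubits `2j + 1` and `2j + 2` are adjacent and carry copies of the logical bits `j`
and `j + 1`. -/
lemma implements_controlledPhase (j : ℕ) (hj : j + 1 < n) (w : ℂ) :
    Implements (onQubits (neighbours (2 * j + 1) (by omega)) (controlledPhase w))
      (onQubits (neighbours j hj) (controlledPhase w)) := by
  rw [controlledPhase, onQubits_diagonal, onQubits_diagonal]
  refine implements_diagonal fun x => ?_
  have h0 : (neighbours (n := n * 2) (2 * j + 1) (by omega) 0).divNat = neighbours j hj 0 := by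
    ext; simp only [Fin.coe_divNat, neighbours_val, Fin.val_zero]; omega
  have h1 : (neighbours (n := n * 2) (2 * j + 1) (by omega) 1).divNat = neighbours j hj 1 := by
    ext; simp only [Fin.coe_divNat, neighbours_val, Fin.val_one]; omega
  simp only [Function.comp_apply, encode, h0, h1]

/-- Exchanging two encoded qubits by fermionic swaps: the four signs cancel. -/
lemma implements_swap (j : ℕ) (hj : j + 1 < n) :
    Implements
      (onQubits (neighbours (2 * j + 1) (by omega)) fermionicSwap *
        (onQubits (neighbours (2 * j) (by omega)) fermionicSwap *
          (onQubits (neighbours (2 * j + 2) (by omega)) fermionicSwap *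
            onQubits (neighbours (2 * j + 1) (by omega)) fermionicSwap)))
      (swapGate ⟨j, by omega⟩ ⟨j + 1, hj⟩) := by
  simp only [onQubits_fermionicSwap, signedPermGate_mul]
  set p0 : Fin (n * 2) := ⟨2 * j, by omega⟩ with hp0
  set p1 : Fin (n * 2) := ⟨2 * j + 1, by omega⟩ with hp1
  set p2 : Fin (n * 2) := ⟨2 * j + 2, by omega⟩ with hp2
  set p3 : Fin (n * 2) := ⟨2 * j + 3, by omega⟩ with hp3
  have e00 : neighbours (n := n * 2) (2 * j) (by omega) 0 = p0 := rfl
  have e01 : neighbours (n := n * 2) (2 * j) (by omega) 1 = p1 := rfl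
  have e10 : neighbours (n := n * 2) (2 * j + 1) (by omega) 0 = p1 := rfl
  have e11 : neighbours (n := n * 2) (2 * j + 1) (by omega) 1 = p2 := rfl
  have e20 : neighbours (n := n * 2) (2 * j + 2) (by omega) 0 = p2 := rfl
  have e21 : neighbours (n := n * 2) (2 * j + 2) (by omega) 1 = p3 := rfl
  simp only [e00, e01, e10, e11, e20, e21]
  have n01 : p0 ≠ p1 := by simp [hp0, hp1]
  have n02 : p0 ≠ p2 := by simp [hp0, hp2]
  have n03 : p0 ≠ p3 := by simp [hp0, hp3]
  have n12 : p1 ≠ p2 := by simp [hp1, hp2]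
  have n13 : p1 ≠ p3 := by simp [hp1, hp3]
  have n23 : p2 ≠ p3 := by simp [hp2, hp3]
  have d0 : p0.divNat = ⟨j, by omega⟩ := by ext; simp [hp0, Fin.divNat]
  have d1 : p1.divNat = ⟨j, by omega⟩ := by ext; simp [hp1, Fin.divNat]; omega
  have d2 : p2.divNat = ⟨j + 1, hj⟩ := by ext; simp [hp2, Fin.divNat]
  have d3 : p3.divNat = ⟨j + 1, hj⟩ := by ext; simp [hp3, Fin.divNat]; omega
  have fix12_0 : Equiv.swap p1 p2 p0 = p0 := Equiv.swap_apply_of_ne_of_ne n01 n02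
  have fix12_3 : Equiv.swap p1 p2 p3 = p3 := Equiv.swap_apply_of_ne_of_ne n13.symm n23.symm
  have fix23_0 : Equiv.swap p2 p3 p0 = p0 := Equiv.swap_apply_of_ne_of_ne n02 n03
  have fix23_1 : Equiv.swap p2 p3 p1 = p1 := Equiv.swap_apply_of_ne_of_ne n12 n13
  have fix01_2 : Equiv.swap p0 p1 p2 = p2 := Equiv.swap_apply_of_ne_of_ne n02.symm n12.symm
  have fix01_3 : Equiv.swap p0 p1 p3 = p3 := Equiv.swap_apply_of_ne_of_ne n03.symm n13.symm
  refine implements_signedPermGate (fun y => ?_) fun i => ?_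
  -- Each of the four swaps crosses a copy of logical bit `j` with a copy of logical bit `j + 1`, so
  -- the same sign occurs four times.
  · simp only [Function.comp_apply, encode, Equiv.Perm.mul_apply, Equiv.swap_apply_left,
      Equiv.swap_apply_right, fix12_0, fix12_3, fix23_0, fix23_1, fix01_2, d0, d1, d2, d3]
    split_ifs <;> simp_all
  · simp only [Equiv.Perm.mul_apply]
    by_cases i0 : i = p0
    · simp only [i0, Equiv.swap_apply_left, fix12_0, fix23_1, d0, d2]
    by_cases i1 : i = p1
    · simp only [i1, Equiv.swap_apply_left, fix12_3, fix01_2, d1, d3]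
    by_cases i2 : i = p2
    · simp only [i2, Equiv.swap_apply_right, fix12_0, fix23_0, d0, d2]
    by_cases i3 : i = p3
    · simp only [i3, Equiv.swap_apply_right, fix12_3, fix01_3, d1, d3]
    rw [Equiv.swap_apply_of_ne_of_ne i1 i2, Equiv.swap_apply_of_ne_of_ne i0 i1,
      Equiv.swap_apply_of_ne_of_ne i2 i3, Equiv.swap_apply_of_ne_of_ne i1 i2,
      Equiv.swap_apply_of_ne_of_ne]
    · intro h
      have h' : (i : ℕ) / 2 = j := congrArg Fin.val h
      rw [Fin.ext_iff] at i0 i1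
      simp only [hp0, hp1] at i0 i1
      omega
    · intro h
      have h' : (i : ℕ) / 2 = j + 1 := congrArg Fin.val h
      rw [Fin.ext_iff] at i2 i3
      simp only [hp2, hp3] at i2 i3
      omega

end Encoding

/-! ### Compilation and gate counts -/

section Compilation

variable {n : ℕ} {S : Set (Gate 2)}

/-- The logical operator `U` is performed by a nearest-neighbour circuit of at most `k` gates of
`S`. -/
def PerformedWithin (S : Set (Gate 2)) (k : ℕ) (U : Gate n) : Prop :=
  ∃ C, IsCircuit (nearestNeighbour S (n * 2)) C ∧ Implements C.prod U ∧ C.length ≤ k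

namespace PerformedWithin

lemma one (k : ℕ) : PerformedWithin S k (1 : Gate n) :=
  ⟨[], by simp [IsCircuit], by simp [Implements], by simp⟩

lemma mono {k m : ℕ} {U : Gate n} (h : PerformedWithin S k U) (hkm : k ≤ m) :
    PerformedWithin S m U := by
  obtain ⟨C, h1, h2, h3⟩ := h
  exact ⟨C, h1, h2, h3.trans hkm⟩

lemma mul {k m : ℕ} {U V : Gate n} (hU : PerformedWithin S k U) (hV : PerformedWithin S m V) :
    PerformedWithin S (k + m) (U * V) := by
  obtain ⟨C, h1, h2, h3⟩ := hU
  obtain ⟨D, g1, g2, g3⟩ := hV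
  refine ⟨C ++ D, ?_, ?_, ?_⟩
  · intro X hX
    rcases List.mem_append.1 hX with hX | hX
    exacts [h1 X hX, g1 X hX]
  · rw [List.prod_append]
    exact h2.mul g2
  · rw [List.length_append]
    omega

lemma list_prod {k : ℕ} (L : List (Gate n)) (h : ∀ U ∈ L, PerformedWithin S k U) :
    PerformedWithin S (k * L.length) L.prod := by
  induction L with
  | nil => exact one _
  | cons U L ih =>
    rw [List.prod_cons]
    refine ((h U (by simp)).mul (ih fun V hV => h V (by simp [hV]))).mono ?_
    rw [List.length_cons]
    exact (by ring : k + k * L.length = k * (L.length + 1)).le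

lemma oneQubit (hS : matchgates ⊆ S) (j : Fin n) {W : Matrix (Fin 2) (Fin 2) ℂ}
    (hW : W ∈ unitaryGroup (Fin 2) ℂ) : PerformedWithin S 1 (multiplexor j fun _ => W) := by
  refine ⟨[onQubits (neighbours (2 * j) (by omega)) (G W (diagonal ![1, W.det]))], ?_, ?_,
    by simp⟩
  · intro V hV
    rw [List.mem_singleton.1 hV]
    exact ⟨2 * j, by omega, _, hS (G_det_mem_matchgates hW), rfl⟩
  · rw [List.prod_singleton]
    exact implements_G j W _

lemma neighbourPhase {w : ℂ} {V V' : Gate 2} (hV : V ∈ S) (hV' : V' ∈ S)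
    (h : V * V' = controlledPhase w) (j : ℕ) (hj : j + 1 < n) :
    PerformedWithin S 2 (onQubits (neighbours j hj) (controlledPhase w)) := by
  refine ⟨[onQubits (neighbours (2 * j + 1) (by omega)) V,
    onQubits (neighbours (2 * j + 1) (by omega)) V'], ?_, ?_, by simp⟩
  · intro X hX
    simp only [List.mem_cons, List.not_mem_nil, or_false] at hX
    rcases hX with rfl | rfl
    exacts [⟨_, _, V, hV, rfl⟩, ⟨_, _, V', hV', rfl⟩]
  · rw [List.prod_cons, List.prod_singleton, ← onQubits_mul, h]
    exact implements_controlledPhase j hj w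

lemma neighbourSwap (hS : matchgates ⊆ S) (j : ℕ) (hj : j + 1 < n) :
    PerformedWithin S 4 (swapGate (⟨j, by omega⟩ : Fin n) ⟨j + 1, hj⟩) := by
  have hF := hS fermionicSwap_mem_matchgates
  refine ⟨[onQubits (neighbours (2 * j + 1) (by omega)) fermionicSwap,
    onQubits (neighbours (2 * j) (by omega)) fermionicSwap,
    onQubits (neighbours (2 * j + 2) (by omega)) fermionicSwap,
    onQubits (neighbours (2 * j + 1) (by omega)) fermionicSwap], ?_, ?_, by simp⟩
  · intro X hX
    simp only [List.mem_cons, List.not_mem_nil, or_false] at hX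
    rcases hX with rfl | rfl | rfl | rfl <;> exact ⟨_, _, _, hF, rfl⟩
  · simp only [List.prod_cons, List.prod_nil, mul_one]
    exact implements_swap j hj

/-- A two-qubit gate on distant qubits costs at most eight gates per unit of distance more than
on neighbours. -/
lemma twoQubit_of_lt (hS : matchgates ⊆ S) {k : ℕ} {U : Gate 2}
    (hU : ∀ (j : ℕ) (hj : j + 1 < n), PerformedWithin S k (onQubits (neighbours j hj) U)) (d : ℕ) :
    ∀ f : Fin 2 ↪ Fin n, (f 1 : ℕ) = f 0 + 1 + d → PerformedWithin S (k + 8 * d) (onQubits f U) := by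
  induction d with
  | zero =>
    intro f hf
    have hj : (f 0 : ℕ) + 1 < n := by have := (f 1).2; omega
    have : f = neighbours (f 0) hj := by
      ext i
      fin_cases i
      · rfl
      · exact hf
    rw [this]
    exact hU _ hj
  | succ d ih =>
    intro f hf
    set j : ℕ := f 0 + 1 + d with hjd
    have hj : j + 1 < n := by have := (f 1).2; omega
    have h1 : f 1 = ⟨j + 1, hj⟩ := Fin.ext (show (f 1 : ℕ) = j + 1 by omega)
    have hswap := neighbourSwap (n := n) hS j hj
    have h0 : Equiv.swap (⟨j, by omega⟩ : Fin n) ⟨j + 1, hj⟩ (f 0) = f 0 :=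
      Equiv.swap_apply_of_ne_of_ne (by rw [Ne, Fin.ext_iff]; simp only; omega)
        (by rw [Ne, Fin.ext_iff]; simp only; omega)
    -- Conjugation by a neighbour swap brings the far qubit one step closer; the two swaps cost four
    -- gates each.
    rw [← swapGate_conj (⟨j, by omega⟩ : Fin n) ⟨j + 1, hj⟩]
    refine ((hswap.mul (ih _ ?_)).mul hswap).mono (by omega)
    simp only [Function.Embedding.trans_apply, Equiv.coe_toEmbedding]
    rw [h0, h1, Equiv.swap_apply_right]

end PerformedWithin

lemma submatrix_mem_unitaryGroup {ι κ : Type*} [Fintype ι] [DecidableEq ι] [Fintype κ]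
    [DecidableEq κ] {U : Matrix ι ι ℂ} (hU : U ∈ unitaryGroup ι ℂ) (e : κ ≃ ι) :
    U.submatrix e e ∈ unitaryGroup κ ℂ := by
  rw [mem_unitaryGroup_iff, star_eq_conjTranspose, conjTranspose_submatrix, submatrix_mul_equiv,
    ← star_eq_conjTranspose, mem_unitaryGroup_iff.1 hU, submatrix_one_equiv]

lemma onQubits_comp_equiv {k : ℕ} (f : Fin k ↪ Fin n) (σ : Equiv.Perm (Fin k)) (U : Gate k) :
    onQubits f U = onQubits (σ.toEmbedding.trans f)
      (U.submatrix (σ.arrowCongr (Equiv.refl (Fin 2))) (σ.arrowCongr (Equiv.refl (Fin 2)))) := by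
  ext x y
  simp only [onQubits, submatrix_apply]
  refine if_congr ?_ ?_ rfl
  · refine forall_congr' fun i => imp_congr_left ?_
    simpa using (σ.surjective.forall (p := fun j => f j ≠ i))
  · congr 1 <;> (ext i; simp [Equiv.arrowCongr])

lemma performedWithin_oneAndTwoQubit (hS : matchgates ⊆ S) {k : ℕ}
    (hU : ∀ U ∈ unitaries 2, ∀ (j : ℕ) (hj : j + 1 < n),
      PerformedWithin S k (onQubits (neighbours j hj) U))
    {V : Gate n} (hV : V ∈ oneAndTwoQubit n) : PerformedWithin S ((k + 9) * n) V := by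
  obtain ⟨m, hm1, hm2, f, U, hUm, rfl⟩ := hV
  have hn : 0 < n := (Nat.zero_le _).trans_lt (f ⟨0, hm1⟩).2
  -- The distance is below `n`, and `n ≥ 1` absorbs the constants; the extra 1 covers a one-qubit
  -- gate even when `k = 0`.
  have hbound : k + 8 * n + 1 ≤ (k + 9) * n := by nlinarith
  obtain rfl | rfl : m = 1 ∨ m = 2 := by omega
  · set e : Fin 2 ≃ (Fin 1 → Fin 2) := (Equiv.funUnique (Fin 1) (Fin 2)).symm with he
    have h : U = multiplexor 0 fun _ => U.submatrix e e := by
      ext x y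
      have h' : ∀ z : Fin 1 → Fin 2, e (z 0) = z := fun z => by
        ext i; rw [Subsingleton.elim i 0]; rfl
      rw [multiplexor_apply, if_pos (fun i hi => absurd (Subsingleton.elim i 0) hi),
        submatrix_apply, h', h']
    rw [h, onQubits_multiplexor]
    exact (PerformedWithin.oneQubit hS _ (submatrix_mem_unitaryGroup hUm e)).mono (by omega)
  · rcases lt_trichotomy (f 0 : ℕ) (f 1) with h | h | h
    · have h1 := (f 1).2
      exact (PerformedWithin.twoQubit_of_lt hS (hU U hUm) (f 1 - f 0 - 1) f (by omega)).mono
        (by omega)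
    · exact absurd (f.injective (Fin.ext h)) (by decide)
    · have h1 := (f 0).2
      -- A pair in decreasing order is reversed by relabelling the two inputs of the gate.
      rw [onQubits_comp_equiv f (Equiv.swap 0 1)]
      exact (PerformedWithin.twoQubit_of_lt hS (hU _ (submatrix_mem_unitaryGroup hUm _))
        (f 0 - f 1 - 1) _ (by simp; omega)).mono (by omega)

/-- Matchgates together with two gates that multiply to a nontrivial controlled phase are
universal in the encoding. -/
lemma encodedUniversal_of_controlledPhase (hS : matchgates ⊆ S) {w : ℂ} (hw : ‖w‖ = 1)
    (hw1 : w ≠ 1) {V V' : Gate 2} (hV : V ∈ S) (hV' : V' ∈ S) (h : V * V' = controlledPhase w) :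
    EncodedUniversal S := by
  -- The bound `k` is fixed before `n` and concerns two qubits only, so the final constant depends
  -- on `w` alone; each letter costs at most two physical gates.
  obtain ⟨k, hk⟩ := boundedlyGenerates_localAndControlledPhase hw hw1
  have htwo : ∀ n : ℕ, ∀ U ∈ unitaries 2, ∀ (j : ℕ) (hj : j + 1 < n),
      PerformedWithin S (2 * k) (onQubits (neighbours j hj) U) := by
    intro n U hU j hj
    obtain ⟨l, hl, rfl, hlen⟩ := hk U hU
    rw [onQubits_list_prod]
    refine (PerformedWithin.list_prod (k := 2) _ ?_).mono (by rw [List.length_map]; omega)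
    intro X hX
    obtain ⟨Y, hY, rfl⟩ := List.mem_map.1 hX
    rcases hl Y hY with ⟨t, W, hW, rfl⟩ | rfl
    · rw [onQubits_multiplexor]
      exact (PerformedWithin.oneQubit hS _ hW).mono (by norm_num)
    · exact PerformedWithin.neighbourPhase hV hV' h j hj
  have hcompile : ∀ (n : ℕ) (L : List (Gate n)), IsCircuit (oneAndTwoQubit n) L →
      PerformedWithin S ((2 * k + 9) * n * L.length) L.prod := fun n L hL =>
    PerformedWithin.list_prod L fun U hU =>
      performedWithin_oneAndTwoQubit hS (htwo n) (hL U hU)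
  refine ⟨fun n hn U hU => ?_, 2 * k + 9, hcompile⟩
  -- This bound depends on `n`; for the first claim only finiteness matters.
  obtain ⟨m, hm⟩ := boundedlyGenerates_oneAndTwoQubit hn
  obtain ⟨L, hL, rfl, -⟩ := hm U hU
  obtain ⟨C, h1, h2, -⟩ := hcompile n L hL
  exact ⟨C, h1, h2⟩

end Compilation

end MatchgateUniversality

open MatchgateUniversality in
theorem theorem2 (A B : Matrix (Fin 2) (Fin 2) ℂ) (hG : G A B ∈ unitaries 2)
    (hdet : A.det ≠ B.det) :
    EncodedUniversal (matchgates ∪ {G A B}) := by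
  obtain ⟨w, hw, hw1, V, hV, h⟩ := exists_matchgate_mul_eq_controlledPhase hG hdet
  exact encodedUniversal_of_controlledPhase Set.subset_union_left hw hw1 (Or.inr rfl) (Or.inl hV) h
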